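/- Let $X_1,X_2,\dots$ be independent random points, each uniformly distributed on $[0,1]^2$, and set $V_n=\{X_1,\dots,X_n\}$ and $r_n=\sqrt{\ln n/(\pi n)}$. Distances are Euclidean and $B(x,s)$ is the closed disk of radius $s$ around $x$. For $0<\eta<1/\sqrt2$, $r>0$ and a set $V$ of points of the plane, put $r'=r(1-\eta\sqrt2)$. Let $\mathcal H_\eta(r)$ be the graph whose vertices are the points of $[0,1]^2$ both of whose coordinates are integer multiples of $\eta r$, two distinct vertices being adjacent iff their distance is at most $r'$. A vertex $p$ is dense if the square $p+[0,\eta r)^2$ contains at least $100$ points of $V$, and sparse otherwise; $p$ is bad if all vertices of $\mathcal H_\eta(r)$ in $B(p,r')$ (including $p$ itself) are sparse. Let $\mathcal D_\eta(V,r)$ and $\mathcal B_\eta(V,r)$ be the subgraphs of $\mathcal H_\eta(r)$ induced by the dense and by the bad vertices, respectively. A component is a connected component, and its diameter $\operatorname{diam}$ is the geometric diameter of its set of vertices. Consider the following properties. (P1) Every component $C$ of $\mathcal D_\eta(V,r)$ has $\operatorname{diam}(C)<r'$ or $\operatorname{diam}(C)>1000r$. (P2) If $C_1\neq C_2$ are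 components of $\mathcal D_\eta(V,r)$ with $\operatorname{diam}(C_1),\operatorname{diam}(C_2)<r'$ and $p_1\in C_1$, $p_2\in C_2$, then $\|p_1-p_2\|>1000r$. (P3) If $C$ is a component of $\mathcal D_\eta(V,r)$ with $\operatorname{diam}(C)<r'$, $p_1\in C$ and $p_2\in\mathcal B_\eta(V,r)$, then $\|p_1-p_2\|>1000r$. (P4) If $p,q\in\mathcal B_\eta(V,r)$, then $\|p-q\|<r'$ or $\|p-q\|>1000r$. (P5) If $p_1,p_2\in\mathcal D_\eta(V,r)$, $\|p_1-p_2\|<25r$, and neither $p_1$ nor $p_2$ lies in a component of $\mathcal D_\eta(V,r)$ of diameter $<r'$, then there is a path from $p_1$ to $p_2$ in $\mathcal D_\eta(V,r)$ all of whose vertices lie in $B(p_1,100r)$. (P6) $\mathcal D_\eta(V,r)$ has exactly one component $C$ with $\operatorname{diam}(C)\ge r'$. Then there is a constant $\eta_0\in(0,1/\sqrt2]$ such that for every fixed $\eta$ with $0<\eta<\eta_0$, the probability that (P1)–(P6) all hold for $V=V_n$ and $r=r_n$ tends to $1$ as $n\to\infty$. -/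

import Mathlib

open MeasureTheory ProbabilityTheory Filter Topology

noncomputable section

namespace HamRGG

/-- The Euclidean plane. -/
abbrev Plane : Type := EuclideanSpace ℝ (Fin 2)

/-- The closed unit square `[0,1]²`. -/
def unitSquare : Set Plane := {z | ∀ i, z i ∈ Set.Icc (0 : ℝ) 1}

/-- The geometric graph with vertex set `V` and threshold distance `s`: two distinct points of `V`
are adjacent iff their Euclidean distance is at most `s`. -/
def geometricGraph (V : Set Plane) (s : ℝ) : SimpleGraph V where
  Adj v w := v ≠ w ∧ dist (v : Plane) (w : Plane) ≤ s
  symm := ⟨fun v w h => ⟨h.1.symm, by rw [dist_comm]; exact h.2⟩⟩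
  loopless := ⟨fun _ h => h.1 rfl⟩

/-- The points of `[0,1]²` both of whose coordinates are integer multiples of `η r`. -/
def gridPoints (η r : ℝ) : Set Plane :=
  {p | p ∈ unitSquare ∧ ∀ i, ∃ k : ℤ, p i = k * (η * r)}

/-- The reduced radius `r' = r (1 - η √2)`. -/
def reducedRadius (η r : ℝ) : ℝ := r * (1 - η * √2)

/-- The graph `H_η(r)`: the geometric graph on the grid points with threshold `r'`. -/
def gridGraph (η r : ℝ) : SimpleGraph (gridPoints η r) :=
  geometricGraph (gridPoints η r) (reducedRadius η r)

/-- The half-open square `p + [0, η r)²`. -/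
def cell (η r : ℝ) (p : Plane) : Set Plane :=
  {z | ∀ i, z i ∈ Set.Ico (p i) (p i + η * r)}

/-- A grid point is dense if its cell contains at least `100` points of `V`. -/
def IsDense (η : ℝ) (V : Set Plane) (r : ℝ) (p : gridPoints η r) : Prop :=
  100 ≤ (V ∩ cell η r p).encard

/-- A grid point `p` is bad if all grid points in the closed disk `B(p, r')`
(so `p` itself and all its neighbours in `H_η(r)`) are sparse, that is, not dense. -/
def IsBad (η : ℝ) (V : Set Plane) (r : ℝ) (p : gridPoints η r) : Prop :=
  ∀ q : gridPoints η r,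
    (q : Plane) ∈ Metric.closedBall (p : Plane) (reducedRadius η r) → ¬ IsDense η V r q

/-- The graph `D_η(V, r)`: the subgraph of `H_η(r)` induced by the dense points. -/
def denseGraph (η : ℝ) (V : Set Plane) (r : ℝ) : SimpleGraph {p | IsDense η V r p} :=
  (gridGraph η r).induce {p | IsDense η V r p}

/-- The graph `B_η(V, r)`: the subgraph of `H_η(r)` induced by the bad points. The properties below
only speak about its vertices. -/
def badGraph (η : ℝ) (V : Set Plane) (r : ℝ) : SimpleGraph {p | IsBad η V r p} :=
  (gridGraph η r).induce {p | IsBad η V r p}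

/-- The set of points of the plane that make up a connected component of `D_η(V, r)`. -/
def componentPoints {η : ℝ} {V : Set Plane} {r : ℝ}
    (C : (denseGraph η V r).ConnectedComponent) : Set Plane :=
  (fun p : {p | IsDense η V r p} => ((p : gridPoints η r) : Plane)) '' C.supp

/-- The geometric diameter of a connected component of `D_η(V, r)`. -/
def geomDiam {η : ℝ} {V : Set Plane} {r : ℝ}
    (C : (denseGraph η V r).ConnectedComponent) : ℝ :=
  Metric.diam (componentPoints C)

/-- The six structural properties of `H_η(r)`, `D_η(V, r)` and `B_η(V, r)`. -/
structure GoodStructure (η : ℝ) (V : Set Plane) (r : ℝ) : Prop where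
  /-- Every component of `D_η(V, r)` has diameter `< r'` or `> 1000 r`. -/
  small_or_large : ∀ C : (denseGraph η V r).ConnectedComponent,
    geomDiam C < reducedRadius η r ∨ 1000 * r < geomDiam C
  /-- Points of distinct small components of `D_η(V, r)` have distance `> 1000 r`. -/
  small_far_small : ∀ C₁ C₂ : (denseGraph η V r).ConnectedComponent, C₁ ≠ C₂ →
    geomDiam C₁ < reducedRadius η r → geomDiam C₂ < reducedRadius η r →
    ∀ p₁ ∈ componentPoints C₁, ∀ p₂ ∈ componentPoints C₂, 1000 * r < dist p₁ p₂
  /-- Points of small components of `D_η(V, r)` have distance `> 1000 r` to all bad points. -/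
  small_far_bad : ∀ C : (denseGraph η V r).ConnectedComponent,
    geomDiam C < reducedRadius η r →
    ∀ p₁ ∈ componentPoints C, ∀ p₂ : {p | IsBad η V r p},
      1000 * r < dist p₁ (p₂ : Plane)
  /-- Two bad points have distance `< r'` or `> 1000 r`. -/
  bad_near_or_far : ∀ p q : {p | IsBad η V r p},
    dist (p : Plane) (q : Plane) < reducedRadius η r ∨ 1000 * r < dist (p : Plane) (q : Plane)
  /-- Two points of `D_η(V, r)` at distance `< 25 r`, neither in a small component, are joined by
  a path in `D_η(V, r)` all of whose vertices lie in the disk `B(p₁, 100 r)`. -/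
  locally_connected : ∀ p₁ p₂ : {p | IsDense η V r p},
    dist (p₁ : Plane) (p₂ : Plane) < 25 * r →
    ¬ geomDiam ((denseGraph η V r).connectedComponentMk p₁) < reducedRadius η r →
    ¬ geomDiam ((denseGraph η V r).connectedComponentMk p₂) < reducedRadius η r →
    ∃ w : (denseGraph η V r).Walk p₁ p₂, w.IsPath ∧
      ∀ q ∈ w.support, (q : Plane) ∈ Metric.closedBall (p₁ : Plane) (100 * r)
  /-- Exactly one component of `D_η(V, r)` has diameter `≥ r'`. -/
  unique_large : ∃! C : (denseGraph η V r).ConnectedComponent,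
    reducedRadius η r ≤ geomDiam C

/-- The radius `r_n = √(ln n / (π n))`. -/
def radius (n : ℕ) : ℝ := √(Real.log n / (Real.pi * n))

/-- The random point set `V_n = {X_1, …, X_n}`, the sequence being indexed from `0` here. -/
def pointSet {Ω : Type*} (X : ℕ → Ω → Plane) (n : ℕ) (ω : Ω) : Set Plane :=
  {z | ∃ i < n, X i ω = z}

end HamRGG

end

/-! In units of the mesh ηr the dense vertices form a set D of lattice points of [0,M]², and
adjacency means distance at most ρ = 1/η − √2. Randomness enters only through `SparseBound`: a
window of radius about 1010r contains fewer than (k₁k₂π/4 + 0.2)/η² sparse cells, where kᵢ ∈ {1,2}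
counts the sides in direction i that are far from its centre.

This bound is likely to hold. If s given cells are sparse, a region of area s(ηr)² holds at most 99s
points although sη² ln n/π are expected. The Chernoff bound `measureReal_card_le_le` makes this cost
nearly n^(−sη²/π), up to constants. At the threshold the exponent exceeds 1 in the interior, 1/2
along a side and 0 at a corner, while there are O(n), O(√n) and O(1) such windows; each has
boundedly many sets of cells (`measureReal_sparseEvent_le`).

The rest is deterministic. First, isoperimetry (`exists_boundary`): a lattice set of diameter nearly
ρ or more, but within the window scale, has at least as many cells near but outside it as the
threshold allows. Its topmost and bottommost points carry k₁k₂ quarter discs beyond the set, and a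
rectangle beside a horizontally extreme point supplies the surplus. So some dense vertex lies near
but outside the set (`SparseBound.exists_dense_near`). Applied to a component, two small components,
a small component with a bad vertex, or two bad vertices, this contradicts their maximality or
badness and gives (P1)–(P4).

Second, at most 30 coarse squares of side about ρ/3 in a window of coarse radius 200 miss D
(`SparseBound.nearlyFull`). Most rows and columns of coarse squares are therefore fully occupied and
form a connected net. A component leaving the window crosses more than 30 columns or rows, hence a
good one, and joins the net inside the window. This gives (P5); overlapping nets give (P6). -/

noncomputable section

namespace HamRGG

/-! ### Isoperimetry for lattice sets in a square. -/

/-- Lattice points at Euclidean distance at most `ρ`. -/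
def Near (ρ : ℝ) (p q : ℤ × ℤ) : Prop :=
  ((p.1 - q.1 : ℤ) : ℝ) ^ 2 + ((p.2 - q.2 : ℤ) : ℝ) ^ 2 ≤ ρ ^ 2

theorem Near.symm {ρ : ℝ} {p q : ℤ × ℤ} (h : Near ρ p q) : Near ρ q p := by
  unfold Near at *
  push_cast at *
  nlinarith

/-- The lattice points of an open quarter plane at distance at most `ρ` from its corner. -/
def quarterDisc (ρ : ℝ) : Finset (ℤ × ℤ) :=
  (Finset.Icc 1 ⌊ρ⌋ ×ˢ Finset.Icc 1 ⌊ρ⌋).filter fun a => (a.1 : ℝ) ^ 2 + (a.2 : ℝ) ^ 2 ≤ ρ ^ 2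

/-- The signs of the two sides of `[0, M]` that are further than `L` from `x`. -/
def farSides (M L x : ℤ) : Finset ℤ :=
  ({1, -1} : Finset ℤ).filter fun σ => x + σ * L ∈ Finset.Icc 1 (M - 1)

/-- The cells of `[0, M)²` at sup distance at most `L` from `c`. -/
def windowCells (M L : ℤ) (c : ℤ × ℤ) : Finset (ℤ × ℤ) :=
  (Finset.Icc (c.1 - L) (c.1 + L) ∩ Finset.Ico 0 M) ×ˢ
    (Finset.Icc (c.2 - L) (c.2 + L) ∩ Finset.Ico 0 M)

theorem mem_windowCells {M L : ℤ} {c q : ℤ × ℤ} : q ∈ windowCells M L c ↔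
    ((c.1 - L ≤ q.1 ∧ q.1 ≤ c.1 + L) ∧ 0 ≤ q.1 ∧ q.1 < M) ∧
    ((c.2 - L ≤ q.2 ∧ q.2 ≤ c.2 + L) ∧ 0 ≤ q.2 ∧ q.2 < M) := by
  simp [windowCells]

theorem mem_farSides {M L x σ : ℤ} : σ ∈ farSides M L x ↔
    (σ = 1 ∨ σ = -1) ∧ 1 ≤ x + σ * L ∧ x + σ * L ≤ M - 1 := by
  simp [farSides]

theorem farSides_nonempty {M L x : ℤ} (hL : 1 ≤ L) (hM : 2 * L + 2 ≤ M) (h0 : 0 ≤ x) (h1 : x ≤ M) :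
    (farSides M L x).Nonempty := by
  by_cases h : x + L ≤ M - 1 ∧ 1 ≤ x + L
  · exact ⟨1, by rw [mem_farSides]; omega⟩
  · exact ⟨-1, by rw [mem_farSides]; omega⟩

theorem exists_extreme (C : Finset (ℤ × ℤ)) (hC : C.Nonempty) (f : ℤ × ℤ → ℤ) (τ : ℤ) :
    ∃ e ∈ C, ∀ p ∈ C, τ * f p ≤ τ * f e :=
  C.exists_max_image (fun p => τ * f p) hC

/-- The cells at distance at most `ρ` from a set of large vertical extent. -/
theorem exists_vertical_boundary {M L : ℤ} {ρ : ℝ} (hρ : 1 ≤ ρ) {C : Finset (ℤ × ℤ)} {c₀ : ℤ × ℤ}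
    (hc₀ : c₀ ∈ C) (hbox : ∀ p ∈ C, (0 ≤ p.1 ∧ p.1 ≤ M) ∧ 0 ≤ p.2 ∧ p.2 ≤ M)
    (hL : ∀ p ∈ C, |p.1 - c₀.1| + ⌊ρ⌋ + 1 ≤ L ∧ |p.2 - c₀.2| + ⌊ρ⌋ + 1 ≤ L)
    (hfar : (farSides M L c₀.1).Nonempty)
    (hext : ∃ p ∈ C, ∃ q ∈ C, 2 * ⌊0.35 * ρ⌋ ≤ p.2 - q.2) :
    ∃ S : Finset (ℤ × ℤ), (∀ s ∈ S, s ∈ windowCells M L c₀ ∧ s ∉ C ∧ ∃ c ∈ C, Near ρ c s) ∧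
      (farSides M L c₀.1).card * (farSides M L c₀.2).card * (quarterDisc ρ).card +
        ⌊0.9 * ρ⌋.toNat * (⌊0.35 * ρ⌋ - 1).toNat ≤ S.card := by
  classical
  have hCne : C.Nonempty := ⟨c₀, hc₀⟩
  -- `e 1` is a topmost and `e (-1)` a bottommost point; `g` below is extreme towards a far vertical
  -- side.
  choose e heC he using fun τ => exists_extreme C hCne Prod.snd τ
  obtain ⟨σ₀, hσ₀⟩ := hfar
  obtain ⟨g, hgC, hg⟩ := exists_extreme C hCne Prod.fst σ₀
  have hR9 : ⌊0.9 * ρ⌋ ≤ ⌊ρ⌋ := Int.floor_mono (by linarith)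
  have hR3 : ⌊0.35 * ρ⌋ ≤ ⌊ρ⌋ := Int.floor_mono (by linarith)
  have hw9 : (⌊0.9 * ρ⌋ : ℝ) ≤ 0.9 * ρ := Int.floor_le _
  have hw3 : (⌊0.35 * ρ⌋ : ℝ) ≤ 0.35 * ρ := Int.floor_le _
  set w := ⌊0.35 * ρ⌋ with hw
  set v := ⌊0.9 * ρ⌋ with hv
  set R := ⌊ρ⌋ with hR
  -- Vertical extent at least `2 * w` leaves room `w` above or below `g`. A block of height `w - 1`
  -- placed there does not get past the level of `e τ₀`.
  have hτ₀ : ∃ τ₀ : ℤ, (τ₀ = 1 ∨ τ₀ = -1) ∧ w ≤ τ₀ * ((e τ₀).2 - g.2) := by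
    obtain ⟨p, hp, q, hq, hpq⟩ := hext
    have h1 := he 1 p hp
    have h2 := he (-1) q hq
    by_cases h : w ≤ (e 1).2 - g.2
    · exact ⟨1, by simp, by omega⟩
    · exact ⟨-1, by simp, by omega⟩
  obtain ⟨τ₀, hτ₀, hτw⟩ := hτ₀
  -- `F` attaches quarter discs strictly above the top or below the bottom point, `G` a rectangle
  -- strictly beyond `g`. Both avoid `C` by extremality, and only far sides are used, so both stay
  -- in the window.
  let F : ((ℤ × ℤ) × (ℤ × ℤ)) → ℤ × ℤ := fun x =>
    ((e x.1.2).1 + x.1.1 * x.2.1, (e x.1.2).2 + x.1.2 * x.2.2)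
  let G : ℤ × ℤ → ℤ × ℤ := fun x => (g.1 + σ₀ * x.1, g.2 + τ₀ * x.2)
  let A := (farSides M L c₀.1 ×ˢ farSides M L c₀.2) ×ˢ quarterDisc ρ
  let B := Finset.Icc 1 v ×ˢ Finset.Icc 1 (w - 1)
  have hA : ∀ x, x ∈ A → ((x.1.1 = 1 ∨ x.1.1 = -1) ∧ 1 ≤ c₀.1 + x.1.1 * L ∧
      c₀.1 + x.1.1 * L ≤ M - 1) ∧ ((x.1.2 = 1 ∨ x.1.2 = -1) ∧ 1 ≤ c₀.2 + x.1.2 * L ∧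
      c₀.2 + x.1.2 * L ≤ M - 1) ∧ (1 ≤ x.2.1 ∧ x.2.1 ≤ R) ∧ (1 ≤ x.2.2 ∧ x.2.2 ≤ R) ∧
      (x.2.1 : ℝ) ^ 2 + (x.2.2 : ℝ) ^ 2 ≤ ρ ^ 2 := by
    intro x hx
    simp only [A, Finset.mem_product, mem_farSides, quarterDisc, Finset.mem_filter,
      Finset.mem_Icc] at hx
    tauto
  have hB : ∀ x, x ∈ B → (1 ≤ x.1 ∧ x.1 ≤ v) ∧ 1 ≤ x.2 ∧ x.2 ≤ w - 1 := by
    intro x hx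
    simpa only [B, Finset.mem_product, Finset.mem_Icc] using hx
  rw [mem_farSides] at hσ₀
  have hFinj : Set.InjOn F A := by
    rintro ⟨⟨σ, τ⟩, a, b⟩ hx ⟨⟨σ', τ'⟩, a', b'⟩ hy hxy
    obtain ⟨⟨hσ, -⟩, ⟨hτ, -⟩, ha, hb, -⟩ := hA _ hx
    obtain ⟨⟨hσ', -⟩, ⟨hτ', -⟩, ha', hb', -⟩ := hA _ hy
    simp only [F, Prod.mk.injEq] at hxy hσ hσ' hτ hτ' ha ha' hb hb' ⊢
    have h1 := he 1 (e (-1)) (heC _)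
    have hττ : τ = τ' := by
      rcases hτ with rfl | rfl <;> rcases hτ' with rfl | rfl <;> first | rfl | omega
    subst hττ
    rcases hτ with rfl | rfl <;> rcases hσ with rfl | rfl <;> rcases hσ' with rfl | rfl <;> omega
  have hGinj : Set.InjOn G B := by
    rintro ⟨a, b⟩ hx ⟨a', b'⟩ hy hxy
    simp only [G, Prod.mk.injEq] at hxy ⊢
    rcases hσ₀.1 with rfl | rfl <;> rcases hτ₀ with rfl | rfl <;> omega
  have hdisj : Disjoint (A.image F) (B.image G) := by
    rw [Finset.disjoint_left]
    rintro _ hz hz'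
    obtain ⟨⟨⟨σ, τ⟩, a, b⟩, hx, rfl⟩ := Finset.mem_image.1 hz
    obtain ⟨⟨a', b'⟩, hy, hxy⟩ := Finset.mem_image.1 hz'
    obtain ⟨⟨hσ, -⟩, ⟨hτ, -⟩, ha, hb, -⟩ := hA _ hx
    have hb' := hB _ hy
    have h1 := he 1 (e (-1)) (heC _)
    have h2 := he 1 g hgC
    have h3 := he (-1) g hgC
    simp only [F, G, Prod.mk.injEq] at *
    rcases hτ with rfl | rfl <;> rcases hτ₀ with rfl | rfl <;> omega
  refine ⟨A.image F ∪ B.image G, ?_, ?_⟩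
  · intro s hs
    rcases Finset.mem_union.1 hs with hs | hs
    · obtain ⟨⟨⟨σ, τ⟩, a, b⟩, hx, rfl⟩ := Finset.mem_image.1 hs
      obtain ⟨⟨hσ, hσ1⟩, ⟨hτ, hτ1⟩, ha, hb, hab⟩ := hA _ hx
      simp only [F] at *
      have h1 := hbox _ (heC τ)
      have h2 := hL _ (heC τ)
      refine ⟨?_, ?_, e τ, heC τ, ?_⟩
      · rw [mem_windowCells]
        simp only [abs_le, ← le_sub_iff_add_le] at h2
        rcases hσ with rfl | rfl <;> rcases hτ with rfl | rfl <;> dsimp only <;> omega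
      · intro hmem
        have := he τ _ hmem
        rcases hτ with rfl | rfl <;> dsimp only at this <;> omega
      · unfold Near
        dsimp only
        push_cast
        rcases hσ with rfl | rfl <;> rcases hτ with rfl | rfl <;> push_cast <;> nlinarith
    · obtain ⟨⟨a, b⟩, hx, rfl⟩ := Finset.mem_image.1 hs
      have hab := hB _ hx
      simp only [G] at *
      have h1 := hbox _ hgC
      have h2 := hL _ hgC
      have h3 := hbox _ (heC τ₀)
      refine ⟨?_, ?_, g, hgC, ?_⟩
      · rw [mem_windowCells]
        obtain ⟨hσ, hσ1⟩ := hσ₀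
        simp only [← le_sub_iff_add_le, abs_sub_le_iff] at h2
        rcases hσ with rfl | rfl <;> rcases hτ₀ with rfl | rfl <;> dsimp only <;> omega
      · intro hmem
        have := hg _ hmem
        rcases hσ₀.1 with rfl | rfl <;> dsimp only at this <;> omega
      · unfold Near
        dsimp only
        have ha : (a : ℝ) ≤ 0.9 * ρ := le_trans (by exact_mod_cast hab.1.2) hw9
        have hb : (b : ℝ) ≤ 0.35 * ρ := le_trans (by exact_mod_cast (by omega : b ≤ w)) hw3
        have ha0 : (0 : ℝ) ≤ a := by exact_mod_cast (by omega : (0 : ℤ) ≤ a)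
        have hb0 : (0 : ℝ) ≤ b := by exact_mod_cast (by omega : (0 : ℤ) ≤ b)
        -- The rectangle fits into the disc around `g`, as 0.9² + 0.35² < 1.
        have ha2 : (a : ℝ) ^ 2 ≤ (0.9 * ρ) ^ 2 := by gcongr
        have hb2 : (b : ℝ) ^ 2 ≤ (0.35 * ρ) ^ 2 := by gcongr
        rcases hσ₀.1 with rfl | rfl <;> rcases hτ₀ with rfl | rfl <;> push_cast <;> nlinarith
  · rw [Finset.card_union_of_disjoint hdisj, Finset.card_image_of_injOn hFinj,
      Finset.card_image_of_injOn hGinj]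
    simp [A, B]

/-- The cells at distance at most `ρ` from a set of large extent. -/
theorem exists_boundary {M L : ℤ} {ρ : ℝ} (hρ : 1 ≤ ρ) {C : Finset (ℤ × ℤ)} {c₀ : ℤ × ℤ}
    (hc₀ : c₀ ∈ C) (hbox : ∀ p ∈ C, (0 ≤ p.1 ∧ p.1 ≤ M) ∧ 0 ≤ p.2 ∧ p.2 ≤ M)
    (hL : ∀ p ∈ C, |p.1 - c₀.1| + ⌊ρ⌋ + 1 ≤ L ∧ |p.2 - c₀.2| + ⌊ρ⌋ + 1 ≤ L)
    (hM : 2 * L + 2 ≤ M)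
    (hext : ∃ p ∈ C, ∃ q ∈ C, 2 * ⌊0.35 * ρ⌋ ≤ p.1 - q.1 ∨ 2 * ⌊0.35 * ρ⌋ ≤ p.2 - q.2) :
    ∃ S : Finset (ℤ × ℤ), (∀ s ∈ S, s ∈ windowCells M L c₀ ∧ s ∉ C ∧ ∃ c ∈ C, Near ρ c s) ∧
      (farSides M L c₀.1).card * (farSides M L c₀.2).card * (quarterDisc ρ).card +
        ⌊0.9 * ρ⌋.toNat * (⌊0.35 * ρ⌋ - 1).toNat ≤ S.card := by
  classical
  have hL0 : 1 ≤ L := by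
    have h := (hL _ hc₀).1
    have : 0 ≤ ⌊ρ⌋ := Int.floor_nonneg.2 (by linarith)
    simp at h
    omega
  have hb₀ := hbox _ hc₀
  obtain ⟨p, hp, q, hq, h | h⟩ := hext
  -- Large horizontal extent is reduced to the vertical case by swapping coordinates.
  · obtain ⟨S, hS, hcard⟩ := exists_vertical_boundary (M := M) (L := L) hρ
      (C := C.image Prod.swap) (c₀ := c₀.swap) (Finset.mem_image_of_mem _ hc₀)
      (by
        intro x hx
        obtain ⟨y, hy, rfl⟩ := Finset.mem_image.1 hx
        exact (hbox y hy).symm)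
      (by
        intro x hx
        obtain ⟨y, hy, rfl⟩ := Finset.mem_image.1 hx
        exact (hL y hy).symm)
      (farSides_nonempty hL0 hM hb₀.2.1 hb₀.2.2)
      ⟨p.swap, Finset.mem_image_of_mem _ hp, q.swap, Finset.mem_image_of_mem _ hq, h⟩
    refine ⟨S.image Prod.swap, ?_, ?_⟩
    · intro s hs
      obtain ⟨y, hy, rfl⟩ := Finset.mem_image.1 hs
      obtain ⟨h1, h2, c, hc, h3⟩ := hS y hy
      refine ⟨?_, ?_, ?_⟩
      · rw [mem_windowCells] at h1 ⊢
        exact h1.symm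
      · intro h
        exact h2 (by simpa using Finset.mem_image_of_mem Prod.swap h)
      · obtain ⟨d, hd, rfl⟩ := Finset.mem_image.1 hc
        refine ⟨d, hd, ?_⟩
        unfold Near at h3 ⊢
        rw [add_comm] at h3
        exact h3
    · rw [Finset.card_image_of_injective _ Prod.swap_injective]
      simp only [Prod.fst_swap, Prod.snd_swap] at hcard
      rwa [mul_comm (farSides M L c₀.1).card]
  · exact exists_vertical_boundary hρ hc₀ hbox hL (farSides_nonempty hL0 hM hb₀.1.1 hb₀.1.2)
      ⟨p, hp, q, hq, h⟩

/-! ### Chains of lattice points and coarse coordinates. -/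

/-- Two lattice points are joined by a chain of points of `D` with steps of length at most `ρ`. -/
def Joined (ρ : ℝ) (D : Set (ℤ × ℤ)) : ℤ × ℤ → ℤ × ℤ → Prop :=
  Relation.ReflTransGen fun x y => x ∈ D ∧ y ∈ D ∧ Near ρ x y

theorem Joined.symm {ρ : ℝ} {D : Set (ℤ × ℤ)} {x y : ℤ × ℤ} (h : Joined ρ D x y) :
    Joined ρ D y x := by
  induction h with
  | refl => exact Relation.ReflTransGen.refl
  | tail _ h ih => exact (Relation.ReflTransGen.single ⟨h.2.1, h.1, h.2.2.symm⟩).trans ih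

theorem Joined.mono {ρ : ℝ} {D E : Set (ℤ × ℤ)} (hDE : D ⊆ E) {x y : ℤ × ℤ}
    (h : Joined ρ D x y) : Joined ρ E x y := by
  induction h with
  | refl => exact Relation.ReflTransGen.refl
  | tail _ h ih => exact ih.tail ⟨hDE h.1, hDE h.2.1, h.2.2⟩

theorem Joined.trans {ρ : ℝ} {D : Set (ℤ × ℤ)} {x y z : ℤ × ℤ} (h : Joined ρ D x y)
    (h' : Joined ρ D y z) : Joined ρ D x z :=
  Relation.ReflTransGen.trans h h'

theorem Joined.single {ρ : ℝ} {D : Set (ℤ × ℤ)} {x y : ℤ × ℤ} (hx : x ∈ D) (hy : y ∈ D)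
    (h : Near ρ x y) : Joined ρ D x y :=
  Relation.ReflTransGen.single ⟨hx, hy, h⟩

theorem Joined.mem {ρ : ℝ} {D : Set (ℤ × ℤ)} {x y : ℤ × ℤ} (h : Joined ρ D x y) (hx : x ∈ D) :
    y ∈ D := by
  induction h with
  | refl => exact hx
  | tail _ h _ => exact h.2.1

theorem Joined.swap {ρ : ℝ} {D : Set (ℤ × ℤ)} {x y : ℤ × ℤ}
    (h : Joined ρ (Prod.swap ⁻¹' D) x y) : Joined ρ D x.swap y.swap := by
  induction h with
  | refl => exact Relation.ReflTransGen.refl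
  | tail _ h ih =>
    refine ih.tail ⟨h.1, h.2.1, ?_⟩
    have := h.2.2
    unfold Near at this ⊢
    rw [add_comm] at this
    exact this

/-- A quantity that changes by at most one per step takes all intermediate values on a chain. -/
theorem exists_joined_eq {ρ : ℝ} {D : Set (ℤ × ℤ)} {x y : ℤ × ℤ} (f : ℤ × ℤ → ℤ)
    (hf : ∀ p ∈ D, ∀ q ∈ D, Near ρ p q → |f p - f q| ≤ 1) (h : Joined ρ D x y) {u : ℤ}
    (hu : f x ≤ u ∧ u ≤ f y ∨ f y ≤ u ∧ u ≤ f x) : ∃ z, Joined ρ D x z ∧ f z = u := by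
  induction h with
  | refl => exact ⟨x, Relation.ReflTransGen.refl, by omega⟩
  | @tail b c hb hbc ih =>
    by_cases hc : f c = u
    · exact ⟨c, hb.tail hbc, hc⟩
    · have := abs_le.1 (hf b hbc.1 c hbc.2.1 hbc.2.2)
      exact ih (by omega)

/-- A chain either stays in `W` or has an initial part in `W` followed by a step out of `W`. -/
theorem Joined.stays_or_exits {ρ : ℝ} {D W : Set (ℤ × ℤ)} {x y : ℤ × ℤ} (hx : x ∈ D ∩ W)
    (h : Joined ρ D x y) : Joined ρ (D ∩ W) x y ∨
      ∃ a b, Joined ρ (D ∩ W) x a ∧ b ∈ D ∧ b ∉ W ∧ Near ρ a b := by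
  induction h with
  | refl => exact Or.inl Relation.ReflTransGen.refl
  | @tail b c hb hbc ih =>
    rcases ih with ih | ih
    · by_cases hc : c ∈ W
      · exact Or.inl (ih.tail ⟨ih.mem hx, ⟨hbc.2.1, hc⟩, hbc.2.2⟩)
      · exact Or.inr ⟨b, c, ih, hbc.2.1, hc, hbc.2.2⟩
    · exact Or.inr ih

theorem ediv_bounds {m : ℤ} (hm : 1 ≤ m) (i : ℤ) : i / m * m ≤ i ∧ i < i / m * m + m := by
  have h1 := Int.ediv_mul_le i (b := m) (by omega)
  have h2 := Int.lt_ediv_add_one_mul_self i (b := m) (by omega)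
  rw [add_mul, one_mul] at h2
  exact ⟨h1, h2⟩

theorem ediv_le_add {m : ℤ} (hm : 1 ≤ m) {i j k : ℤ} (h : i - j ≤ k * m) : i / m ≤ j / m + k := by
  rw [← Int.add_mul_ediv_right j k (by omega : m ≠ 0)]
  exact Int.ediv_le_ediv (by omega) (by omega)

/-- The coarse coordinate of a lattice coordinate; the last coarse interval is longer. -/
def coarse (M m i : ℤ) : ℤ := min (i / m) (M / m - 1)

theorem abs_coarse_sub_le {M m i j k : ℤ} (hm : 1 ≤ m) (h : |i - j| ≤ k * m) :
    |coarse M m i - coarse M m j| ≤ k := by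
  have hk : 0 ≤ k := by
    by_contra hk
    have := abs_nonneg (i - j)
    nlinarith
  rw [abs_le] at h
  have h1 := ediv_le_add hm (i := i) (j := j) (k := k) (by omega)
  have h2 := ediv_le_add hm (i := j) (j := i) (k := k) (by omega)
  unfold coarse
  rw [abs_le]
  omega

/-- The last interval absorbs the remainder of `M` modulo `m`, so its length stays below `2 * m`. -/
theorem coarse_bounds {M m i : ℤ} (hm : 1 ≤ m) (hi : i ≤ M) :
    coarse M m i * m ≤ i ∧ i < coarse M m i * m + 2 * m := by
  have h1 := ediv_bounds hm i
  have h2 : i / m ≤ M / m := Int.ediv_le_ediv (by omega) hi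
  unfold coarse
  rcases le_or_gt (i / m) (M / m - 1) with h | h
  · rw [min_eq_left h]
    omega
  · rw [min_eq_right h.le]
    have : i / m = M / m := by omega
    rw [this] at h1
    have : (M / m - 1) * m = M / m * m - m := by ring
    omega

theorem coarse_range {M m i : ℤ} (hm : 1 ≤ m) (hM : 1 ≤ M / m) (hi : 0 ≤ i) :
    0 ≤ coarse M m i ∧ coarse M m i < M / m := by
  have : 0 ≤ i / m := Int.ediv_nonneg hi (by omega)
  unfold coarse
  omega

theorem coarse_eq {M m i : ℤ} (h : i / m < M / m) : coarse M m i = i / m := by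
  unfold coarse
  omega

/-! ### Nearly full sets and their net of good rows and columns. -/

/-- The coarse squares near `c` without points of `D`. -/
def emptySquares (M m : ℤ) (D : Set (ℤ × ℤ)) (c : ℤ × ℤ) : Finset (ℤ × ℤ) := by
  classical
  exact (windowCells (M / m) 200 c).filter fun s => ∀ q ∈ D, ¬(q.1 / m = s.1 ∧ q.2 / m = s.2)

/-- A set of lattice points of `[0, M]²` that meets nearly all `m × m` squares near each place. -/
structure NearlyFull (M m : ℤ) (ρ : ℝ) (D : Set (ℤ × ℤ)) : Prop where
  m_pos : 1 ≤ m
  rho_nonneg : 0 ≤ ρ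
  rho_le : ρ ≤ 3 * m
  sq_le : 8 * (m : ℝ) ^ 2 ≤ ρ ^ 2
  large : 400 ≤ M / m
  box : ∀ q ∈ D, (0 ≤ q.1 ∧ q.1 ≤ M) ∧ 0 ≤ q.2 ∧ q.2 ≤ M
  few_empty : ∀ c : ℤ × ℤ, (0 ≤ c.1 ∧ c.1 < M / m) → (0 ≤ c.2 ∧ c.2 < M / m) →
    (emptySquares M m D c).card ≤ 30

/-- The lattice points whose coarse coordinates are close to `c`. -/
def coarseWindow (M m : ℤ) (c : ℤ × ℤ) : Set (ℤ × ℤ) :=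
  {q | |coarse M m q.1 - c.1| ≤ 200 ∧ |coarse M m q.2 - c.2| ≤ 200}

/-- All squares of the column `a` near `c` meet `D`. -/
def GoodColumn (M m : ℤ) (D : Set (ℤ × ℤ)) (c : ℤ × ℤ) (a : ℤ) : Prop :=
  ∀ b, (a, b) ∈ windowCells (M / m) 200 c → ∃ q ∈ D, q.1 / m = a ∧ q.2 / m = b

/-- All squares of the row `b` near `c` meet `D`. -/
def GoodRow (M m : ℤ) (D : Set (ℤ × ℤ)) (c : ℤ × ℤ) (b : ℤ) : Prop :=
  GoodColumn M m (Prod.swap ⁻¹' D) c.swap b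

/-- The points of `D` in good rows and columns near `c`. -/
def goodLines (M m : ℤ) (D : Set (ℤ × ℤ)) (c : ℤ × ℤ) : Set (ℤ × ℤ) :=
  {z | z ∈ D ∧ (z.1 / m, z.2 / m) ∈ windowCells (M / m) 200 c ∧
    (GoodColumn M m D c (z.1 / m) ∨ GoodRow M m D c (z.2 / m))}

theorem swap_mem_windowCells {M L : ℤ} {c q : ℤ × ℤ} :
    q.swap ∈ windowCells M L c.swap ↔ q ∈ windowCells M L c := by
  simp only [mem_windowCells, Prod.fst_swap, Prod.snd_swap]
  tauto

theorem coarseWindow_swap (M m : ℤ) (c : ℤ × ℤ) :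
    coarseWindow M m c.swap = Prod.swap ⁻¹' coarseWindow M m c := by
  ext q
  simp [coarseWindow, and_comm]

theorem mem_coarseWindow_of_mem {M m : ℤ} {c q : ℤ × ℤ}
    (h : (q.1 / m, q.2 / m) ∈ windowCells (M / m) 200 c) : q ∈ coarseWindow M m c := by
  rw [mem_windowCells] at h
  dsimp only at h
  simp only [coarseWindow, Set.mem_ofPred_eq, coarse_eq h.1.2.2, coarse_eq h.2.2.2, abs_le]
  omega

namespace NearlyFull

variable {M m : ℤ} {ρ : ℝ} {D : Set (ℤ × ℤ)}

theorem swap (h : NearlyFull M m ρ D) : NearlyFull M m ρ (Prod.swap ⁻¹' D) where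
  m_pos := h.m_pos
  rho_nonneg := h.rho_nonneg
  rho_le := h.rho_le
  sq_le := h.sq_le
  large := h.large
  box q hq := (h.box _ hq).symm
  few_empty c h1 h2 := by
    classical
    refine le_trans (le_of_eq ?_) (h.few_empty c.swap h2 h1)
    rw [← Finset.card_image_of_injective _ Prod.swap_injective]
    congr 1
    ext s
    simp only [emptySquares, Finset.mem_image, Finset.mem_filter]
    constructor
    · rintro ⟨t, ⟨ht, ht'⟩, rfl⟩
      exact ⟨swap_mem_windowCells.2 ht, fun q hq hqt => ht' q.swap (by simpa using hq) hqt.symm⟩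
    · rintro ⟨hs, hs'⟩
      refine ⟨s.swap, ⟨?_, fun q hq hqt => hs' _ hq hqt.symm⟩, by simp⟩
      rw [← swap_mem_windowCells]
      simpa using hs

theorem near_of_abs (h : NearlyFull M m ρ D) {p q : ℤ × ℤ} (h1 : |p.1 - q.1| ≤ 2 * m)
    (h2 : |p.2 - q.2| ≤ 2 * m) : Near ρ p q := by
  have e1 : (p.1 - q.1) ^ 2 ≤ (2 * m) ^ 2 := sq_le_sq' (by linarith [abs_le.1 h1]) (abs_le.1 h1).2
  have e2 : (p.2 - q.2) ^ 2 ≤ (2 * m) ^ 2 := sq_le_sq' (by linarith [abs_le.1 h2]) (abs_le.1 h2).2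
  have e3 : (((p.1 - q.1) ^ 2 + (p.2 - q.2) ^ 2 : ℤ) : ℝ) ≤ ((8 * m ^ 2 : ℤ) : ℝ) := by
    exact_mod_cast (by linarith)
  have := h.sq_le
  unfold Near
  push_cast at e3 ⊢
  linarith

/-- Two squares sharing a side or a corner lie in a square of side `2 * m`, whose diagonal is at
most `ρ` by `sq_le`. -/
theorem near_of_adjacent (h : NearlyFull M m ρ D) {p q : ℤ × ℤ} (h1 : |p.1 / m - q.1 / m| ≤ 1)
    (h2 : |p.2 / m - q.2 / m| ≤ 1) : Near ρ p q := by
  have key : ∀ i j : ℤ, |i / m - j / m| ≤ 1 → |i - j| ≤ 2 * m := by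
    intro i j hij
    have hi := ediv_bounds h.m_pos i
    have hj := ediv_bounds h.m_pos j
    have hm := h.m_pos
    rw [abs_le] at hij ⊢
    constructor <;> nlinarith
  exact h.near_of_abs (key _ _ h1) (key _ _ h2)

theorem abs_coarse_sub_le_three (h : NearlyFull M m ρ D) {p q : ℤ × ℤ} (hpq : Near ρ p q) :
    |coarse M m p.1 - coarse M m q.1| ≤ 3 := by
  refine abs_coarse_sub_le h.m_pos ?_
  unfold Near at hpq
  have h1 : ((p.1 - q.1 : ℤ) : ℝ) ^ 2 ≤ ρ ^ 2 := by nlinarith [sq_nonneg ((p.2 - q.2 : ℤ) : ℝ)]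
  have h2 := abs_le_of_sq_le_sq h1 h.rho_nonneg
  have h3 := h.rho_le
  rw [← Int.cast_abs] at h2
  exact_mod_cast h2.trans h3

/-- Every square of the column between the two points contains a point of `D`, and points in
consecutive squares are near; the induction is on the number of squares. -/
theorem joined_column (h : NearlyFull M m ρ D) {c : ℤ × ℤ} {a : ℤ} (ha : GoodColumn M m D c a)
    {p q : ℤ × ℤ} (hp : p ∈ D) (hq : q ∈ D) (hpa : p.1 / m = a) (hqa : q.1 / m = a)
    (hpw : (a, p.2 / m) ∈ windowCells (M / m) 200 c)
    (hqw : (a, q.2 / m) ∈ windowCells (M / m) 200 c) :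
    Joined ρ (D ∩ coarseWindow M m c) p q := by
  wlog hle : p.2 / m ≤ q.2 / m generalizing p q
  · exact (this hq hp hqa hpa hqw hpw (by omega)).symm
  obtain ⟨n, hn⟩ := Int.eq_ofNat_of_zero_le (sub_nonneg.2 hle)
  induction n generalizing q with
  | zero =>
    refine Joined.single ⟨hp, ?_⟩ ⟨hq, ?_⟩ (h.near_of_adjacent ?_ ?_)
    · exact mem_coarseWindow_of_mem (hpa ▸ hpw)
    · exact mem_coarseWindow_of_mem (hqa ▸ hqw)
    · rw [hpa, hqa]; simp
    · rw [abs_le]; omega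
  | succ n ih =>
    have hw : (a, q.2 / m - 1) ∈ windowCells (M / m) 200 c := by
      rw [mem_windowCells] at hpw hqw ⊢
      dsimp only at *
      omega
    obtain ⟨z, hz, hza, hzb⟩ := ha _ hw
    refine (ih hz hza (hzb ▸ hw) (by omega) (by omega)).trans
      (Joined.single ⟨hz, ?_⟩ ⟨hq, ?_⟩ (h.near_of_adjacent ?_ ?_))
    · exact mem_coarseWindow_of_mem (by rw [hza, hzb]; exact hw)
    · exact mem_coarseWindow_of_mem (hqa ▸ hqw)
    · rw [hza, hqa]; simp
    · rw [hzb, abs_le]; omega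

theorem joined_row (h : NearlyFull M m ρ D) {c : ℤ × ℤ} {b : ℤ} (hb : GoodRow M m D c b)
    {p q : ℤ × ℤ} (hp : p ∈ D) (hq : q ∈ D) (hpb : p.2 / m = b) (hqb : q.2 / m = b)
    (hpw : (p.1 / m, b) ∈ windowCells (M / m) 200 c)
    (hqw : (q.1 / m, b) ∈ windowCells (M / m) 200 c) :
    Joined ρ (D ∩ coarseWindow M m c) p q := by
  have := h.swap.joined_column hb (p := p.swap) (q := q.swap) (by simpa using hp)
    (by simpa using hq) hpb hqb (swap_mem_windowCells.2 hpw) (swap_mem_windowCells.2 hqw)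
  rw [coarseWindow_swap, ← Set.preimage_inter] at this
  simpa using this.swap

/-- Each bad column contains its own empty square, and there are at most 30 of these. -/
theorem card_bad_columns (h : NearlyFull M m ρ D) {c : ℤ × ℤ} (h1 : 0 ≤ c.1 ∧ c.1 < M / m)
    (h2 : 0 ≤ c.2 ∧ c.2 < M / m) {s : Finset ℤ} (hs : ∀ a ∈ s, ¬GoodColumn M m D c a) :
    s.card ≤ 30 := by
  classical
  refine le_trans (Finset.card_le_card ?_)
    (Finset.card_image_le.trans (h.few_empty c h1 h2) : ((emptySquares M m D c).image Prod.fst).card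
      ≤ 30)
  intro a ha
  have := hs a ha
  unfold GoodColumn at this
  push Not at this
  obtain ⟨b, hb, hb'⟩ := this
  refine Finset.mem_image.2 ⟨(a, b), ?_, rfl⟩
  simp only [emptySquares, Finset.mem_filter]
  exact ⟨hb, fun q hq hq' => hb' q hq hq'.1 hq'.2⟩

theorem card_bad_rows (h : NearlyFull M m ρ D) {c : ℤ × ℤ} (h1 : 0 ≤ c.1 ∧ c.1 < M / m)
    (h2 : 0 ≤ c.2 ∧ c.2 < M / m) {s : Finset ℤ} (hs : ∀ a ∈ s, ¬GoodRow M m D c a) :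
    s.card ≤ 30 :=
  h.swap.card_bad_columns (c := c.swap) h2 h1 hs

/-- Close coarse centres have a common good row. -/
theorem exists_common_good_row (h : NearlyFull M m ρ D) {c c' : ℤ × ℤ}
    (h1 : 0 ≤ c.1 ∧ c.1 < M / m) (h2 : 0 ≤ c.2 ∧ c.2 < M / m) (h1' : 0 ≤ c'.1 ∧ c'.1 < M / m)
    (h2' : 0 ≤ c'.2 ∧ c'.2 < M / m) (hcc : |c.2 - c'.2| ≤ 1) :
    ∃ b, GoodRow M m D c b ∧ GoodRow M m D c' b ∧ (0 ≤ b ∧ b < M / m) ∧ |b - c.2| ≤ 150 ∧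
      |b - c'.2| ≤ 151 := by
  classical
  have hM := h.large
  -- Among 150 consecutive rows inside the square at most 30 are bad for each of the two centres.
  obtain ⟨t, ht⟩ : ∃ t, 0 ≤ t ∧ t + 150 ≤ M / m ∧ c.2 - 150 ≤ t ∧ t ≤ c.2 := by
    by_cases hc : c.2 + 150 ≤ M / m
    · exact ⟨c.2, by omega⟩
    · exact ⟨c.2 - 150, by omega⟩
  by_contra hcon
  push Not at hcon
  have hcover : Finset.Ico t (t + 150) ⊆
      ((Finset.Ico t (t + 150)).filter fun b => ¬GoodRow M m D c b) ∪
        ((Finset.Ico t (t + 150)).filter fun b => ¬GoodRow M m D c' b) := by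
    intro b hb
    simp only [Finset.mem_union, Finset.mem_filter, hb, true_and]
    by_contra hb'
    push Not at hb'
    rw [Finset.mem_Ico] at hb
    rw [abs_le] at hcc
    have := hcon b hb'.1 hb'.2 (by omega) (by rw [abs_le]; omega)
    rw [lt_abs] at this
    omega
  have := (Finset.card_le_card hcover).trans (Finset.card_union_le _ _)
  have e1 := h.card_bad_rows h1 h2 (s := (Finset.Ico t (t + 150)).filter fun b =>
    ¬GoodRow M m D c b) (fun a ha => (Finset.mem_filter.1 ha).2)
  have e2 := h.card_bad_rows h1' h2' (s := (Finset.Ico t (t + 150)).filter fun b =>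
    ¬GoodRow M m D c' b) (fun a ha => (Finset.mem_filter.1 ha).2)
  rw [Int.card_Ico] at this
  omega

theorem exists_good_row (h : NearlyFull M m ρ D) {c : ℤ × ℤ}
    (h1 : 0 ≤ c.1 ∧ c.1 < M / m) (h2 : 0 ≤ c.2 ∧ c.2 < M / m) :
    ∃ b, GoodRow M m D c b ∧ (0 ≤ b ∧ b < M / m) ∧ |b - c.2| ≤ 150 := by
  obtain ⟨b, hb, -, h3, h4, -⟩ := h.exists_common_good_row h1 h2 h1 h2 (by simp)
  exact ⟨b, hb, h3, h4⟩

theorem exists_good_column (h : NearlyFull M m ρ D) {c : ℤ × ℤ}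
    (h1 : 0 ≤ c.1 ∧ c.1 < M / m) (h2 : 0 ≤ c.2 ∧ c.2 < M / m) :
    ∃ a, GoodColumn M m D c a ∧ (0 ≤ a ∧ a < M / m) ∧ |a - c.1| ≤ 150 :=
  h.swap.exists_good_row (c := c.swap) h2 h1

theorem exists_mem_row {c : ℤ × ℤ} {a b : ℤ} (hb : GoodRow M m D c b)
    (hw : (a, b) ∈ windowCells (M / m) 200 c) : ∃ q ∈ D, q.1 / m = a ∧ q.2 / m = b := by
  obtain ⟨q, hq, h1, h2⟩ := hb a (by simpa using swap_mem_windowCells.2 hw)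
  exact ⟨q.swap, hq, h2, h1⟩

/-- All good lines near `c` are joined to each other near `c`. -/
theorem joined_goodLines (h : NearlyFull M m ρ D) {c : ℤ × ℤ} (h1 : 0 ≤ c.1 ∧ c.1 < M / m)
    (h2 : 0 ≤ c.2 ∧ c.2 < M / m) {p q : ℤ × ℤ} (hp : p ∈ goodLines M m D c)
    (hq : q ∈ goodLines M m D c) : Joined ρ (D ∩ coarseWindow M m c) p q := by
  obtain ⟨b, hb, hb1, hb2⟩ := h.exists_good_row h1 h2
  obtain ⟨a, ha, ha1, ha2⟩ := h.exists_good_column h1 h2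
  rw [abs_le] at ha2 hb2
  have hw : (a, b) ∈ windowCells (M / m) 200 c := by
    rw [mem_windowCells]; dsimp only; omega
  -- One good row and one good column meet at `z`. Every other good line crosses one of the two and
  -- is joined to `z` through it.
  obtain ⟨z, hz, hza, hzb⟩ := ha b hw
  suffices H : ∀ p ∈ goodLines M m D c, Joined ρ (D ∩ coarseWindow M m c) p z from
    (H p hp).trans (H q hq).symm
  rintro p ⟨hp, hpw, hpl⟩
  rw [mem_windowCells] at hpw
  dsimp only at hpw
  rcases hpl with hpl | hpl
  · have hw' : (p.1 / m, b) ∈ windowCells (M / m) 200 c := by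
      rw [mem_windowCells]; dsimp only; omega
    obtain ⟨y, hy, hya, hyb⟩ := hpl b hw'
    exact (h.joined_column hpl hp hy rfl hya (by rw [mem_windowCells]; exact hpw)
      (by rw [hyb]; exact hw')).trans
      (h.joined_row hb hy hz hyb hzb (by rw [hya]; exact hw') (by rw [hza]; exact hw))
  · have hw' : (a, p.2 / m) ∈ windowCells (M / m) 200 c := by
      rw [mem_windowCells]; dsimp only; omega
    obtain ⟨y, hy, hya, hyb⟩ := ha _ hw'
    exact (h.joined_row hpl hp hy rfl hyb (by rw [mem_windowCells]; exact hpw)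
      (by rw [hya]; exact hw')).trans
      (h.joined_column ha hy hz hya hza (by rw [hyb]; exact hw') (by rw [hzb]; exact hw))

/-- The good lines near two close centres meet. -/
theorem goodLines_inter_nonempty (h : NearlyFull M m ρ D) {c c' : ℤ × ℤ}
    (h1 : 0 ≤ c.1 ∧ c.1 < M / m) (h2 : 0 ≤ c.2 ∧ c.2 < M / m) (h1' : 0 ≤ c'.1 ∧ c'.1 < M / m)
    (h2' : 0 ≤ c'.2 ∧ c'.2 < M / m) (hcc₁ : |c.1 - c'.1| ≤ 1) (hcc : |c.2 - c'.2| ≤ 1) :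
    (goodLines M m D c ∩ goodLines M m D c').Nonempty := by
  obtain ⟨b, hb, hb', hb1, hb2, hb3⟩ := h.exists_common_good_row h1 h2 h1' h2' hcc
  rw [abs_le] at *
  have hw : (c.1, b) ∈ windowCells (M / m) 200 c := by
    rw [mem_windowCells]; dsimp only; omega
  have hw' : (c.1, b) ∈ windowCells (M / m) 200 c' := by
    rw [mem_windowCells]; dsimp only; omega
  obtain ⟨z, hz, hza, hzb⟩ := exists_mem_row hb hw
  refine ⟨z, ⟨hz, ?_, Or.inr (hzb ▸ hb)⟩, hz, ?_, Or.inr (hzb ▸ hb')⟩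
  · rw [hza, hzb]; exact hw
  · rw [hza, hzb]; exact hw'

/-- All good lines are joined to each other. -/
theorem joined_goodLines_global (h : NearlyFull M m ρ D) {c c' p q : ℤ × ℤ}
    (h1 : 0 ≤ c.1 ∧ c.1 < M / m) (h2 : 0 ≤ c.2 ∧ c.2 < M / m) (h1' : 0 ≤ c'.1 ∧ c'.1 < M / m)
    (h2' : 0 ≤ c'.2 ∧ c'.2 < M / m) (hp : p ∈ goodLines M m D c) (hq : q ∈ goodLines M m D c') :
    Joined ρ D p q := by
  have hM := h.large
  have step : ∀ c c' : ℤ × ℤ, (0 ≤ c.1 ∧ c.1 < M / m) → (0 ≤ c.2 ∧ c.2 < M / m) →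
      (0 ≤ c'.1 ∧ c'.1 < M / m) → (0 ≤ c'.2 ∧ c'.2 < M / m) → |c.1 - c'.1| ≤ 1 →
      |c.2 - c'.2| ≤ 1 → ∀ r, (∀ p ∈ goodLines M m D c, Joined ρ D p r) →
      ∀ p ∈ goodLines M m D c', Joined ρ D p r := by
    intro c c' h1 h2 h1' h2' h3 h4 r hr p hp
    obtain ⟨z, hz, hz'⟩ := h.goodLines_inter_nonempty h1 h2 h1' h2' h3 h4
    exact ((h.joined_goodLines h1' h2' hp hz').mono Set.inter_subset_left).trans (hr z hz)
  obtain ⟨r, hr, -⟩ := h.goodLines_inter_nonempty (c := (0, 0)) (c' := (0, 0)) (by simp; omega)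
    (by simp; omega) (by simp; omega) (by simp; omega) (by simp) (by simp)
  -- The centre moves from the origin one coarse step at a time; the nets of successive centres
  -- share a point.
  have key : ∀ i : ℕ, (i : ℤ) < M / m → ∀ j : ℕ, (j : ℤ) < M / m →
      ∀ p ∈ goodLines M m D (i, j), Joined ρ D p r := by
    intro i
    induction i with
    | zero =>
      intro _ j
      induction j with
      | zero =>
        intro _ p hp
        exact (h.joined_goodLines (c := (0, 0)) (by simp; omega) (by simp; omega)
          (by simpa using hp) hr).mono Set.inter_subset_left
      | succ j ih =>
        intro hj
        push_cast at hj
        refine step _ _ ?_ ?_ ?_ ?_ ?_ ?_ r (ih (by omega)) <;> simp <;> omega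
    | succ i ih =>
      intro hi j hj
      push_cast at hi
      refine step _ _ ?_ ?_ ?_ ?_ ?_ ?_ r (ih (by omega) j hj) <;> simp <;> omega
  have key' : ∀ c : ℤ × ℤ, (0 ≤ c.1 ∧ c.1 < M / m) → (0 ≤ c.2 ∧ c.2 < M / m) →
      ∀ p ∈ goodLines M m D c, Joined ρ D p r := by
    rintro ⟨i, j⟩ hi hj
    lift i to ℕ using hi.1
    lift j to ℕ using hj.1
    exact key i hi.2 j hj.2
  exact (key' c h1 h2 p hp).trans (key' c' h1' h2' q hq).symm

theorem joined_good_column_of_exit (h : NearlyFull M m ρ D) {c q x : ℤ × ℤ}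
    (h1 : 0 ≤ c.1 ∧ c.1 < M / m) (h2 : 0 ≤ c.2 ∧ c.2 < M / m) (hq : q ∈ D ∩ coarseWindow M m c)
    (hqc : |coarse M m q.1 - c.1| ≤ 80) (hx : Joined ρ (D ∩ coarseWindow M m c) q x)
    (hxc : 198 ≤ |coarse M m x.1 - c.1|) :
    ∃ z ∈ goodLines M m D c, Joined ρ (D ∩ coarseWindow M m c) q z := by
  classical
  have hM := h.large
  -- A step of the chain changes a coarse coordinate by at most 3, so its quotient by 3 skips no
  -- value.
  have ivt := fun u : ℤ => exists_joined_eq (u := u) (fun p => coarse M m p.1 / 3) (ρ := ρ)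
    (D := D ∩ coarseWindow M m c) (x := q) (y := x) (by
      intro p _ q _ hpq
      have := abs_le.1 (h.abs_coarse_sub_le_three hpq)
      rw [abs_le]
      omega) hx
  set fx := coarse M m x.1 / 3 with hfx
  set fq := coarse M m q.1 / 3 with hfq
  -- The coarse coordinate travels from offset at most 80 to at least 198, so the quotient takes
  -- more than 30 values. These belong to distinct columns, one of which must be good.
  obtain ⟨U, hU, hUc⟩ : ∃ U : Finset ℤ, (∀ u ∈ U, fq ≤ u ∧ u ≤ fx ∨ fx ≤ u ∧ u ≤ fq) ∧
      30 < U.card := by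
    rw [abs_le] at hqc
    rw [le_abs] at hxc
    rcases hxc with hxc | hxc
    · refine ⟨Finset.Icc fq fx, fun u hu => Or.inl (Finset.mem_Icc.1 hu), ?_⟩
      rw [Int.card_Icc]
      omega
    · refine ⟨Finset.Icc fx fq, fun u hu => Or.inr (Finset.mem_Icc.1 hu), ?_⟩
      rw [Int.card_Icc]
      omega
  have hy : ∀ u : U, ∃ z, Joined ρ (D ∩ coarseWindow M m c) q z ∧ coarse M m z.1 / 3 = u :=
    fun u => ivt u (hU u u.2)
  choose y hyq hyu using hy
  obtain ⟨u, hu⟩ : ∃ u, GoodColumn M m D c (coarse M m (y u).1) := by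
    by_contra hcon
    push Not at hcon
    have := h.card_bad_columns h1 h2 (s := Finset.univ.image fun u => coarse M m (y u).1) (by
      intro a ha
      obtain ⟨u, -, rfl⟩ := Finset.mem_image.1 ha
      exact hcon u)
    rw [Finset.card_image_of_injective] at this
    · simp at this
      omega
    · intro u v huv
      dsimp only at huv
      ext
      rw [← hyu u, ← hyu v, huv]
  have hyD := (hyq u).mem hq
  set p := y u with hp
  have hbox := h.box _ hyD.1
  have hr1 := coarse_range h.m_pos (by omega : 1 ≤ M / m) hbox.1.1
  have hr2 := coarse_range h.m_pos (by omega : 1 ≤ M / m) hbox.2.1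
  have hw : (coarse M m p.1, coarse M m p.2) ∈ windowCells (M / m) 200 c := by
    have := hyD.2
    simp only [coarseWindow, Set.mem_ofPred_eq, abs_le] at this
    rw [mem_windowCells]
    dsimp only
    omega
  obtain ⟨z, hz, hza, hzb⟩ := hu _ hw
  have hzw : (z.1 / m, z.2 / m) ∈ windowCells (M / m) 200 c := by rw [hza, hzb]; exact hw
  refine ⟨z, ⟨hz, hzw, Or.inl (hza ▸ hu)⟩, (hyq u).trans
    (Joined.single hyD ⟨hz, mem_coarseWindow_of_mem hzw⟩ (h.near_of_abs ?_ ?_))⟩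
  · have e1 := coarse_bounds h.m_pos hbox.1.2
    have e2 := ediv_bounds h.m_pos z.1
    rw [hza] at e2
    change |p.1 - z.1| ≤ 2 * m
    rw [abs_le]
    omega
  · have e1 := coarse_bounds h.m_pos hbox.2.2
    have e2 := ediv_bounds h.m_pos z.2
    rw [hzb] at e2
    change |p.2 - z.2| ≤ 2 * m
    rw [abs_le]
    omega

/-- A point whose component leaves the window around `c` is joined to the good lines inside it. -/
theorem joined_goodLines_of_exit (h : NearlyFull M m ρ D) {c q y : ℤ × ℤ}
    (h1 : 0 ≤ c.1 ∧ c.1 < M / m) (h2 : 0 ≤ c.2 ∧ c.2 < M / m) (hq : q ∈ D)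
    (hq1 : |coarse M m q.1 - c.1| ≤ 80) (hq2 : |coarse M m q.2 - c.2| ≤ 80)
    (hy : Joined ρ D q y) (hyw : y ∉ coarseWindow M m c) :
    ∃ z ∈ goodLines M m D c, Joined ρ (D ∩ coarseWindow M m c) q z := by
  have hqw : q ∈ D ∩ coarseWindow M m c := ⟨hq, by
    simp only [coarseWindow, Set.mem_ofPred_eq]
    omega⟩
  rcases hy.stays_or_exits hqw with hs | ⟨a, b, ha, hb, hbw, hab⟩
  · exact absurd (hs.mem hqw).2 hyw
  have e1 := abs_le.1 (h.abs_coarse_sub_le_three hab)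
  have e2 := abs_le.1 (h.swap.abs_coarse_sub_le_three (p := a.swap) (q := b.swap) (by
    unfold Near at hab ⊢
    rw [add_comm] at hab
    exact hab))
  dsimp only [Prod.fst_swap] at e2
  simp only [coarseWindow, Set.mem_ofPred_eq, abs_le] at hbw
  -- `b` is outside the window, at offset at least 201 in some coordinate; `a` is one step before,
  -- hence at offset at least 198 there.
  by_cases hcase : 198 ≤ |coarse M m a.1 - c.1|
  · exact h.joined_good_column_of_exit h1 h2 hqw hq1 ha hcase
  · have hcase' : 198 ≤ |coarse M m a.2 - c.2| := by
      rw [le_abs] at *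
      omega
    have hE : D ∩ coarseWindow M m c =
        Prod.swap ⁻¹' (Prod.swap ⁻¹' D ∩ coarseWindow M m c.swap) := by
      ext x
      simp [coarseWindow_swap]
    obtain ⟨z, hz, hzq⟩ := h.swap.joined_good_column_of_exit (c := c.swap) (q := q.swap)
      (x := a.swap) h2 h1 (by rw [coarseWindow_swap]; simpa using hqw) hq2
      (by rw [hE] at ha; exact ha.swap) hcase'
    refine ⟨z.swap, ⟨hz.1, swap_mem_windowCells.1 (by simpa using hz.2.1), ?_⟩, ?_⟩
    · exact hz.2.2.symm
    · rw [coarseWindow_swap, ← Set.preimage_inter] at hzq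
      simpa using hzq.swap

/-- The good lines contain two joined points far apart. -/
theorem exists_joined_far (h : NearlyFull M m ρ D) :
    ∃ p ∈ goodLines M m D (0, 0), ∃ q ∈ goodLines M m D (0, 0), ρ < ((q.1 - p.1 : ℤ) : ℝ) := by
  have hM := h.large
  obtain ⟨b, hb, hb1, hb2⟩ := h.exists_good_row (c := (0, 0)) (by simp; omega) (by simp; omega)
  rw [abs_le] at hb2
  dsimp only at hb2
  have hw : ∀ a : ℤ, 0 ≤ a ∧ a ≤ 4 → (a, b) ∈ windowCells (M / m) 200 (0, 0) := by
    intro a ha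
    rw [mem_windowCells]
    dsimp only
    omega
  obtain ⟨p, hp, hpa, hpb⟩ := exists_mem_row hb (hw 0 (by omega))
  obtain ⟨q, hq, hqa, hqb⟩ := exists_mem_row hb (hw 4 (by omega))
  refine ⟨p, ⟨hp, ?_, Or.inr (hpb ▸ hb)⟩, q, ⟨hq, ?_, Or.inr (hqb ▸ hb)⟩, ?_⟩
  · rw [hpa, hpb]; exact hw 0 (by omega)
  · rw [hqa, hqb]; exact hw 4 (by omega)
  -- Columns 0 and 4 are separated by three full columns, so the gap exceeds `3 * m`.
  · have e1 := ediv_bounds h.m_pos p.1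
    have e2 := ediv_bounds h.m_pos q.1
    rw [hpa] at e1
    rw [hqa] at e2
    refine h.rho_le.trans_lt ?_
    exact_mod_cast (by omega : 3 * m < q.1 - p.1)

end NearlyFull

/-! ### Lattice points in a quarter disc. -/

theorem integral_sqrt_sq_sub_sq {ρ : ℝ} (hρ : 0 < ρ) :
    ∫ x in (0 : ℝ)..ρ, √(ρ ^ 2 - x ^ 2) = Real.pi / 4 * ρ ^ 2 := by
  have h1 : ∫ x in (0 : ℝ)..1, √(1 - x ^ 2) = Real.pi / 4 := by
    have hc : Continuous fun x : ℝ => √(1 - x ^ 2) := by fun_prop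
    have e1 := intervalIntegral.integral_add_adjacent_intervals (μ := volume)
      (hc.intervalIntegrable (-1) 0) (hc.intervalIntegrable 0 1)
    have e2 := intervalIntegral.integral_comp_neg (fun x : ℝ => √(1 - x ^ 2)) (a := 0) (b := 1)
    simp only [even_two, Even.neg_pow, neg_zero] at e2
    rw [integral_sqrt_one_sub_sq, ← e2] at e1
    linarith
  have h2 := intervalIntegral.smul_integral_comp_mul_left (fun x : ℝ => √(ρ ^ 2 - x ^ 2)) ρ
    (a := 0) (b := 1)
  rw [mul_zero, mul_one] at h2
  rw [← h2]
  have h3 : ∀ x : ℝ, √(ρ ^ 2 - (ρ * x) ^ 2) = ρ * √(1 - x ^ 2) := by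
    intro x
    rw [show ρ ^ 2 - (ρ * x) ^ 2 = ρ ^ 2 * (1 - x ^ 2) by ring, Real.sqrt_mul (by positivity),
      Real.sqrt_sq hρ.le]
  simp only [h3, intervalIntegral.integral_const_mul, h1, smul_eq_mul]
  ring

/-- The integrand decreases, so its left sum dominates the integral; discarding the term at 0 costs
`ρ`. -/
theorem sub_le_sum_sqrt {ρ : ℝ} (hρ : 0 < ρ) :
    Real.pi / 4 * ρ ^ 2 - ρ ≤ ∑ a ∈ Finset.range ⌊ρ⌋₊, √(ρ ^ 2 - ((a + 1 : ℕ) : ℝ) ^ 2) := by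
  have hanti : AntitoneOn (fun x : ℝ => √(ρ ^ 2 - x ^ 2)) (Set.Icc 0 (0 + ((⌊ρ⌋₊ + 1 : ℕ) : ℝ))) := by
    intro x hx y _ hxy
    have := hx.1
    dsimp only
    gcongr
  have h1 := hanti.integral_le_sum
  have hc : Continuous fun x : ℝ => √(ρ ^ 2 - x ^ 2) := by fun_prop
  have hN : ρ ≤ ((⌊ρ⌋₊ + 1 : ℕ) : ℝ) := by
    push_cast
    exact (Nat.lt_floor_add_one ρ).le
  have h2 : ∫ x in (0 : ℝ)..ρ, √(ρ ^ 2 - x ^ 2) ≤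
      ∫ x in (0 : ℝ)..(0 + ((⌊ρ⌋₊ + 1 : ℕ) : ℝ)), √(ρ ^ 2 - x ^ 2) := by
    rw [zero_add]
    refine intervalIntegral.integral_mono_interval le_rfl hρ.le hN ?_ (hc.intervalIntegrable _ _)
    exact Eventually.of_forall fun x => Real.sqrt_nonneg _
  rw [integral_sqrt_sq_sub_sq hρ] at h2
  rw [Finset.sum_range_succ'] at h1
  simp only [zero_add, CharP.cast_eq_zero] at h1
  have h3 : √(ρ ^ 2 - 0 ^ 2) = ρ := by
    rw [show ρ ^ 2 - 0 ^ 2 = ρ ^ 2 by ring, Real.sqrt_sq hρ.le]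
  rw [h3] at h1
  rw [zero_add] at h2
  linarith

/-- Rounding down loses at most one point in each of at most `ρ` columns; the other `ρ` comes from
`sub_le_sum_sqrt`. -/
theorem sub_le_card_quarterDisc {ρ : ℝ} (hρ : 0 < ρ) :
    Real.pi / 4 * ρ ^ 2 - 2 * ρ ≤ ((quarterDisc ρ).card : ℝ) := by
  classical
  let T : Finset ((_ : ℕ) × ℕ) := (Finset.range ⌊ρ⌋₊).sigma fun a =>
    Finset.range ⌊√(ρ ^ 2 - ((a + 1 : ℕ) : ℝ) ^ 2)⌋₊
  have hT : T.card ≤ (quarterDisc ρ).card := by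
    refine Finset.card_le_card_of_injOn (fun x => ((x.1 : ℤ) + 1, (x.2 : ℤ) + 1)) ?_ ?_
    · rintro ⟨a, b⟩ hab
      simp only [T, Finset.coe_sigma, Set.mem_sigma_iff, Finset.mem_coe, Finset.mem_range] at hab
      obtain ⟨ha, hb⟩ := hab
      have ha' : ((a + 1 : ℕ) : ℝ) ≤ ρ := (Nat.le_floor_iff hρ.le).1 ha
      have hb' : ((b + 1 : ℕ) : ℝ) ≤ √(ρ ^ 2 - ((a + 1 : ℕ) : ℝ) ^ 2) :=
        (Nat.le_floor_iff (Real.sqrt_nonneg _)).1 hb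
      have hsq : ((b + 1 : ℕ) : ℝ) ^ 2 ≤ ρ ^ 2 - ((a + 1 : ℕ) : ℝ) ^ 2 := by
        have h0 : 0 ≤ ρ ^ 2 - ((a + 1 : ℕ) : ℝ) ^ 2 := by
          have : ((a + 1 : ℕ) : ℝ) ^ 2 ≤ ρ ^ 2 := by gcongr
          linarith
        rw [← Real.sq_sqrt h0]
        gcongr
      have hb'' : ((b + 1 : ℕ) : ℝ) ≤ ρ := by
        refine abs_le_of_sq_le_sq' ?_ hρ.le |>.2
        nlinarith [sq_nonneg ((a + 1 : ℕ) : ℝ)]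
      simp only [quarterDisc, Finset.coe_filter, Finset.mem_product, Finset.mem_Icc,
        Set.mem_ofPred_eq, Int.le_floor]
      push_cast at *
      refine ⟨⟨⟨by omega, ha'⟩, by omega, hb''⟩, by linarith⟩
    · rintro ⟨a, b⟩ _ ⟨a', b'⟩ _ hab
      simp only [Prod.mk.injEq, add_left_inj, Nat.cast_inj] at hab
      obtain ⟨rfl, rfl⟩ := hab
      rfl
  have hcard : (T.card : ℝ) = ∑ a ∈ Finset.range ⌊ρ⌋₊,
      (⌊√(ρ ^ 2 - ((a + 1 : ℕ) : ℝ) ^ 2)⌋₊ : ℝ) := by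
    simp [T]
  have hsum : ∑ a ∈ Finset.range ⌊ρ⌋₊, √(ρ ^ 2 - ((a + 1 : ℕ) : ℝ) ^ 2) - ρ ≤ T.card := by
    have : ∑ a ∈ Finset.range ⌊ρ⌋₊, √(ρ ^ 2 - ((a + 1 : ℕ) : ℝ) ^ 2) ≤
        ∑ a ∈ Finset.range ⌊ρ⌋₊, ((⌊√(ρ ^ 2 - ((a + 1 : ℕ) : ℝ) ^ 2)⌋₊ : ℝ) + 1) :=
      Finset.sum_le_sum fun a _ => (Nat.lt_floor_add_one _).le
    rw [Finset.sum_add_distrib, ← hcard] at this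
    simp only [Finset.sum_const, Finset.card_range, nsmul_eq_mul, mul_one] at this
    have hfl := Nat.floor_le hρ.le
    linarith
  have := sub_le_sum_sqrt hρ
  have hT' : (T.card : ℝ) ≤ (quarterDisc ρ).card := by exact_mod_cast hT
  linarith

/-! ### Deterministic consequences of few sparse cells. -/

/-- The radius of the windows, in units of the mesh. -/
def windowRadius (η : ℝ) : ℤ := ⌈1010 / η⌉

/-- The adjacency radius in units of the mesh. -/
def latticeRadius (η : ℝ) : ℝ := 1 / η - √2

/-- The number of non-dense cells that a window may not contain. -/
def threshold (η : ℝ) (M : ℤ) (c : ℤ × ℤ) : ℝ :=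
  ((farSides M (windowRadius η) c.1).card * (farSides M (windowRadius η) c.2).card *
    (Real.pi / 4) + 0.2) / η ^ 2

/-- In all windows there are few cells outside `D`, depending on the distance to the sides. -/
structure SparseBound (η : ℝ) (M : ℤ) (D : Set (ℤ × ℤ)) : Prop where
  box : ∀ q ∈ D, (0 ≤ q.1 ∧ q.1 ≤ M) ∧ 0 ≤ q.2 ∧ q.2 ≤ M
  few_sparse : ∀ c : ℤ × ℤ, (0 ≤ c.1 ∧ c.1 ≤ M) → (0 ≤ c.2 ∧ c.2 ≤ M) →
    ∀ S : Finset (ℤ × ℤ), S ⊆ windowCells M (windowRadius η) c → (∀ s ∈ S, s ∉ D) →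
      (S.card : ℝ) < threshold η M c

theorem card_farSides_le (M L x : ℤ) : (farSides M L x).card ≤ 2 :=
  (Finset.card_filter_le _ _).trans (by simp)

section
variable {η : ℝ}

theorem latticeRadius_bounds (h0 : 0 < η) (h1 : η < 1 / 1000) :
    998 < latticeRadius η ∧ latticeRadius η < 1 / η ∧ 1 / η < latticeRadius η + 1.42 := by
  have h2 : 1000 < 1 / η := by rw [lt_div_iff₀ h0]; linarith
  have h3 : √2 < 1.42 := by rw [Real.sqrt_lt' (by norm_num)]; norm_num
  have h4 : 0 < √2 := by positivity
  unfold latticeRadius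
  refine ⟨by linarith, by linarith, by linarith⟩

/-- The quarter discs match the main term. The rectangle has about 0.9 · 0.35 ρ² = 0.315ρ² cells
against the required 0.2/η², and the difference pays for the errors linear in ρ because ρ > 998. -/
theorem threshold_le_card (h0 : 0 < η) (h1 : η < 1 / 1000) {M : ℤ} (c : ℤ × ℤ) :
    threshold η M c ≤ (((farSides M (windowRadius η) c.1).card *
      (farSides M (windowRadius η) c.2).card * (quarterDisc (latticeRadius η)).card +
        ⌊0.9 * latticeRadius η⌋.toNat * (⌊0.35 * latticeRadius η⌋ - 1).toNat : ℕ) : ℝ) := by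
  obtain ⟨hρ, -, hη⟩ := latticeRadius_bounds h0 h1
  set ρ := latticeRadius η
  have hk1 := card_farSides_le M (windowRadius η) c.1
  have hk2 := card_farSides_le M (windowRadius η) c.2
  have hk : (farSides M (windowRadius η) c.1).card * (farSides M (windowRadius η) c.2).card ≤ 4 :=
    (Nat.mul_le_mul hk1 hk2).trans (by norm_num)
  unfold threshold
  set k := (farSides M (windowRadius η) c.1).card * (farSides M (windowRadius η) c.2).card with hkk
  have hk' : (k : ℝ) ≤ 4 := by exact_mod_cast hk
  have hk0 : (0 : ℝ) ≤ k := by positivity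
  have hQ := sub_le_card_quarterDisc (ρ := ρ) (by linarith)
  have hv : 0.9 * ρ - 1 ≤ (⌊0.9 * ρ⌋.toNat : ℝ) := by
    have e1 := Int.sub_one_lt_floor (0.9 * ρ)
    have e2 : (⌊0.9 * ρ⌋ : ℝ) ≤ (⌊0.9 * ρ⌋.toNat : ℝ) := by
      exact_mod_cast Int.self_le_toNat _
    linarith
  have hw : 0.35 * ρ - 2 ≤ ((⌊0.35 * ρ⌋ - 1).toNat : ℝ) := by
    have e1 := Int.sub_one_lt_floor (0.35 * ρ)
    have e2 : ((⌊0.35 * ρ⌋ - 1 : ℤ) : ℝ) ≤ ((⌊0.35 * ρ⌋ - 1).toNat : ℝ) := by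
      exact_mod_cast Int.self_le_toNat _
    push_cast at e2
    linarith
  have hvw : (0.9 * ρ - 1) * (0.35 * ρ - 2) ≤
      (⌊0.9 * ρ⌋.toNat : ℝ) * ((⌊0.35 * ρ⌋ - 1).toNat : ℝ) := by
    gcongr
    linarith
  have hkQ := mul_le_mul_of_nonneg_left hQ hk0
  push_cast
  have hkc : ((farSides M (windowRadius η) c.1).card : ℝ) * (farSides M (windowRadius η) c.2).card
      = k := by rw [hkk]; push_cast; ring
  rw [hkc, div_eq_mul_one_div, ← one_div_pow]
  have hη2 : (1 / η) ^ 2 ≤ (ρ + 1.42) ^ 2 := by gcongr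
  have hpi := Real.pi_lt_four
  have hpi0 := Real.pi_pos
  have hkp0 : 0 ≤ (k : ℝ) * (Real.pi / 4) := by positivity
  have hkp : (k : ℝ) * (Real.pi / 4) ≤ 4 := by nlinarith
  have e1 : ((k : ℝ) * (Real.pi / 4) + 0.2) * (1 / η) ^ 2 ≤
      ((k : ℝ) * (Real.pi / 4) + 0.2) * (ρ + 1.42) ^ 2 := by gcongr
  have e2 : (k : ℝ) * (Real.pi / 4) * (2 * 1.42 * ρ + 1.42 ^ 2) ≤ 4 * (2 * 1.42 * ρ + 1.42 ^ 2) := by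
    gcongr
  have e3 : (k : ℝ) * (2 * ρ) ≤ 4 * (2 * ρ) := by gcongr
  nlinarith

/-- A set of large but bounded extent cannot be surrounded by cells outside `D` only. -/
theorem SparseBound.exists_near {M : ℤ} {D : Set (ℤ × ℤ)} (h : SparseBound η M D)
    (h0 : 0 < η) (h1 : η < 1 / 1000) (hM : 2 * windowRadius η + 2 ≤ M) {C : Finset (ℤ × ℤ)}
    {c₀ : ℤ × ℤ} (hc₀ : c₀ ∈ C) (hbox : ∀ p ∈ C, (0 ≤ p.1 ∧ p.1 ≤ M) ∧ 0 ≤ p.2 ∧ p.2 ≤ M)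
    (hL : ∀ p ∈ C, ((|p.1 - c₀.1| : ℤ) : ℝ) ≤ 1003 / η ∧ ((|p.2 - c₀.2| : ℤ) : ℝ) ≤ 1003 / η)
    (hext : ∃ p ∈ C, ∃ q ∈ C, 0.998 * latticeRadius η ^ 2 ≤
      ((p.1 - q.1 : ℤ) : ℝ) ^ 2 + ((p.2 - q.2 : ℤ) : ℝ) ^ 2) :
    ∃ c ∈ C, ∃ s ∈ D, s ∉ C ∧ Near (latticeRadius η) c s := by
  obtain ⟨hρ, hη1, hη⟩ := latticeRadius_bounds h0 h1
  have hL' : ∀ x : ℤ, (x : ℝ) ≤ 1003 / η → x + ⌊latticeRadius η⌋ + 1 ≤ windowRadius η := by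
    intro x hx
    have e1 : (1010 / η : ℝ) ≤ (windowRadius η : ℤ) := Int.le_ceil _
    have e2 : (⌊latticeRadius η⌋ : ℝ) ≤ latticeRadius η := Int.floor_le _
    have e3 : 1010 / η = 1003 / η + 7 * (1 / η) := by ring
    have e4 : (x : ℝ) + ⌊latticeRadius η⌋ + 1 ≤ (windowRadius η : ℤ) := by linarith
    exact_mod_cast e4
  have hext' : ∃ p ∈ C, ∃ q ∈ C, 2 * ⌊0.35 * latticeRadius η⌋ ≤ p.1 - q.1 ∨
      2 * ⌊0.35 * latticeRadius η⌋ ≤ p.2 - q.2 := by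
    obtain ⟨p, hp, q, hq, hpq⟩ := hext
    have hfl := Int.floor_le (0.35 * latticeRadius η)
    have key : ∀ x : ℤ, 0.7 * latticeRadius η ≤ |(x : ℝ)| →
        2 * ⌊0.35 * latticeRadius η⌋ ≤ |x| := by
      intro x hx
      rw [← Int.cast_abs] at hx
      have : ((2 * ⌊0.35 * latticeRadius η⌋ : ℤ) : ℝ) ≤ ((|x| : ℤ) : ℝ) := by
        push_cast at hx ⊢
        linarith
      exact_mod_cast this
    -- If both coordinate differences were below 0.7ρ, the squared distance would be below 0.98ρ².
    have hor : 2 * ⌊0.35 * latticeRadius η⌋ ≤ |p.1 - q.1| ∨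
        2 * ⌊0.35 * latticeRadius η⌋ ≤ |p.2 - q.2| := by
      by_contra! hcon
      have a1 := lt_of_not_ge fun hh => absurd (key _ hh) (not_le.2 hcon.1)
      have a2 := lt_of_not_ge fun hh => absurd (key _ hh) (not_le.2 hcon.2)
      have b1 := sq_lt_sq' (by linarith [abs_nonneg ((p.1 - q.1 : ℤ) : ℝ)]) a1
      have b2 := sq_lt_sq' (by linarith [abs_nonneg ((p.2 - q.2 : ℤ) : ℝ)]) a2
      rw [sq_abs] at b1 b2
      nlinarith
    rcases hor with hor | hor <;> rw [le_abs] at hor <;> rcases hor with hor | hor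
    · exact ⟨p, hp, q, hq, Or.inl hor⟩
    · exact ⟨q, hq, p, hp, Or.inl (by omega)⟩
    · exact ⟨p, hp, q, hq, Or.inr hor⟩
    · exact ⟨q, hq, p, hp, Or.inr (by omega)⟩
  obtain ⟨S, hS, hcard⟩ := exists_boundary (ρ := latticeRadius η) (by linarith) hc₀ hbox
    (fun p hp => ⟨hL' _ (hL p hp).1, hL' _ (hL p hp).2⟩) hM hext'
  by_contra! hcon
  -- If no point of `D` is near `C` outside it, the whole boundary `S` lies outside `D`, yet it is
  -- as large as the threshold.
  have hlt := h.few_sparse c₀ (hbox _ hc₀).1 (hbox _ hc₀).2 S (fun s hs => (hS s hs).1) (by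
    intro s hs hsD
    obtain ⟨-, h3, c, hc, h4⟩ := hS s hs
    exact hcon c hc s hsD h3 h4)
  have hle := threshold_le_card h0 h1 (M := M) c₀
  have hcard' : (((farSides M (windowRadius η) c₀.1).card *
      (farSides M (windowRadius η) c₀.2).card * (quarterDisc (latticeRadius η)).card +
        ⌊0.9 * latticeRadius η⌋.toNat * (⌊0.35 * latticeRadius η⌋ - 1).toNat : ℕ) : ℝ) ≤ S.card := by
    exact_mod_cast hcard
  linarith

/-- The side length of the coarse squares, in units of the mesh. -/
def coarseSide (η : ℝ) : ℤ := ⌈latticeRadius η / 3⌉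

theorem coarseSide_bounds (h0 : 0 < η) (h1 : η < 1 / 1000) :
    latticeRadius η ≤ 3 * coarseSide η ∧ 0.33 / η ≤ coarseSide η ∧
      (coarseSide η : ℝ) ≤ 0.35 / η ∧ 1 ≤ coarseSide η := by
  obtain ⟨hρ, hη1, hη⟩ := latticeRadius_bounds h0 h1
  have e1 : latticeRadius η / 3 ≤ coarseSide η := Int.le_ceil _
  have e2 : (coarseSide η : ℝ) < latticeRadius η / 3 + 1 := Int.ceil_lt_add_one _
  have e3 : 0.33 / η = 0.33 * (1 / η) := by ring
  have e4 : 0.35 / η = 0.35 * (1 / η) := by ring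
  refine ⟨by linarith, by rw [e3]; linarith, by rw [e4]; linarith, ?_⟩
  have : (1 : ℝ) ≤ coarseSide η := by linarith
  exact_mod_cast this

/-- An empty coarse square consists of about ρ²/9 cells outside `D`, and the threshold is at most
3.35/η² since π + 0.2 < 3.35. As 9 · 3.35 = 30.15, a 31st empty square is impossible. -/
theorem SparseBound.nearlyFull {M : ℤ} {D : Set (ℤ × ℤ)} (h : SparseBound η M D)
    (h0 : 0 < η) (h1 : η < 1 / 1000) (hM : 2 * windowRadius η + 2 ≤ M) :
    NearlyFull M (coarseSide η) (latticeRadius η) D := by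
  classical
  obtain ⟨hρ, hη1, hη⟩ := latticeRadius_bounds h0 h1
  obtain ⟨hm1, hm2, hm3, hm4⟩ := coarseSide_bounds h0 h1
  have e2 : (coarseSide η : ℝ) < latticeRadius η / 3 + 1 := Int.ceil_lt_add_one _
  have hL : 201 * coarseSide η ≤ windowRadius η := by
    have e1 : (1010 / η : ℝ) ≤ (windowRadius η : ℤ) := Int.le_ceil _
    have e3 : (1010 / η : ℝ) = 1010 * (1 / η) := by ring
    have : ((201 * coarseSide η : ℤ) : ℝ) ≤ windowRadius η := by
      push_cast
      linarith
    exact_mod_cast this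
  set m := coarseSide η with hm
  set L := windowRadius η with hLdef
  refine ⟨hm4, by linarith, hm1, ?_, ?_, h.box, ?_⟩
  · have : (m : ℝ) ≥ 0 := by exact_mod_cast (by omega : (0 : ℤ) ≤ m)
    nlinarith
  · rw [Int.le_ediv_iff_mul_le (by omega)]
    omega
  · intro c hc1 hc2
    set E := emptySquares M m D c with hE
    have hEmem : ∀ s ∈ E, s ∈ windowCells (M / m) 200 c ∧
        ∀ q ∈ D, ¬(q.1 / m = s.1 ∧ q.2 / m = s.2) := by
      intro s hs
      simpa only [hE, emptySquares, Finset.mem_filter] using hs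
    let B : Finset ((ℤ × ℤ) × (ℤ × ℤ)) := E ×ˢ (Finset.Ico 0 m ×ˢ Finset.Ico 0 m)
    let F : (ℤ × ℤ) × (ℤ × ℤ) → ℤ × ℤ := fun x => (x.1.1 * m + x.2.1, x.1.2 * m + x.2.2)
    have hdiv : ∀ a u : ℤ, 0 ≤ u → u < m → (a * m + u) / m = a := by
      intro a u hu hu'
      rw [add_comm, Int.add_mul_ediv_right _ _ (by omega : m ≠ 0), Int.ediv_eq_zero_of_lt hu hu',
        zero_add]
    have hFdiv : ∀ x ∈ B, (F x).1 / m = x.1.1 ∧ (F x).2 / m = x.1.2 := by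
      rintro x hx
      simp only [B, Finset.mem_product, Finset.mem_Ico] at hx
      exact ⟨hdiv _ _ hx.2.1.1 hx.2.1.2, hdiv _ _ hx.2.2.1 hx.2.2.2⟩
    have hinj : Set.InjOn F B := by
      intro x hx y hy hxy
      obtain ⟨a1, a2⟩ := hFdiv x hx
      obtain ⟨b1, b2⟩ := hFdiv y hy
      rw [hxy] at a1 a2
      have c1 : x.1 = y.1 := Prod.ext (a1.symm.trans b1) (a2.symm.trans b2)
      simp only [F, Prod.mk.injEq, c1, add_right_inj] at hxy
      exact Prod.ext c1 (Prod.ext hxy.1 hxy.2)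
    have hcM : ∀ a : ℤ, a < M / m → a * m + m ≤ M := by
      intro a ha
      have := (ediv_bounds hm4 M).1
      nlinarith
    have hlt := h.few_sparse (c.1 * m, c.2 * m)
      ⟨by dsimp only; nlinarith, by have := hcM _ hc1.2; dsimp only; omega⟩
      ⟨by dsimp only; nlinarith, by have := hcM _ hc2.2; dsimp only; omega⟩ (B.image F) (by
        intro s hs
        obtain ⟨x, hx, rfl⟩ := Finset.mem_image.1 hs
        simp only [B, Finset.mem_product, Finset.mem_Ico] at hx
        obtain ⟨hx1, hx2, hx3⟩ := hx
        have hw := (hEmem _ hx1).1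
        rw [mem_windowCells] at hw ⊢
        have k1 := hcM _ hw.1.2.2
        have k2 := hcM _ hw.2.2.2
        dsimp only [F]
        refine ⟨⟨⟨?_, ?_⟩, ?_, ?_⟩, ⟨?_, ?_⟩, ?_, ?_⟩ <;> nlinarith) (by
        intro s hs hsD
        obtain ⟨x, hx, rfl⟩ := Finset.mem_image.1 hs
        exact (hEmem _ (Finset.mem_product.1 hx).1).2 _ hsD (hFdiv x hx))
    rw [Finset.card_image_of_injOn hinj] at hlt
    have hcardB : B.card = E.card * (m.toNat * m.toNat) := by
      simp [B]
    have hmn : ((m.toNat : ℕ) : ℝ) = m := by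
      exact_mod_cast Int.toNat_of_nonneg (by omega : (0 : ℤ) ≤ m)
    rw [hcardB] at hlt
    push_cast at hlt
    rw [hmn] at hlt
    have hthr : threshold η M (c.1 * m, c.2 * m) ≤ 3.35 * (latticeRadius η + 1.42) ^ 2 := by
      have hk1 : ((farSides M L (c.1 * m)).card : ℝ) ≤ 2 := by exact_mod_cast card_farSides_le _ _ _
      have hk2 : ((farSides M L (c.2 * m)).card : ℝ) ≤ 2 := by exact_mod_cast card_farSides_le _ _ _
      have hpi := Real.pi_lt_d2
      have hpi0 := Real.pi_pos
      unfold threshold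
      rw [div_eq_mul_one_div, ← one_div_pow]
      have : ((farSides M L (c.1 * m)).card : ℝ) * (farSides M L (c.2 * m)).card * (Real.pi / 4)
          ≤ 2 * 2 * (Real.pi / 4) := by gcongr
      gcongr
      · linarith
    by_contra! hcon
    have hcon' : (31 : ℝ) ≤ E.card := by exact_mod_cast hcon
    have hmm : (latticeRadius η / 3) ^ 2 ≤ (m : ℝ) * m := by
      rw [← sq]
      gcongr
      linarith
    have : 31 * (latticeRadius η / 3) ^ 2 ≤ (E.card : ℝ) * (m * m) := by gcongr
    nlinarith

end

/-! ### Transfer to the grid graph and the six properties. -/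

/-- The grid point with indices `q` of the square grid of mesh `h`. -/
def latticePoint (h : ℝ) (q : ℤ × ℤ) : Plane := !₂[q.1 * h, q.2 * h]

@[simp] theorem latticePoint_zero (h : ℝ) (q : ℤ × ℤ) : latticePoint h q 0 = q.1 * h := rfl

@[simp] theorem latticePoint_one (h : ℝ) (q : ℤ × ℤ) : latticePoint h q 1 = q.2 * h := rfl

theorem dist_latticePoint {h : ℝ} (hh : 0 ≤ h) (p q : ℤ × ℤ) :
    dist (latticePoint h p) (latticePoint h q) =
      h * √(((p.1 - q.1 : ℤ) : ℝ) ^ 2 + ((p.2 - q.2 : ℤ) : ℝ) ^ 2) := by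
  rw [EuclideanSpace.dist_eq, Fin.sum_univ_two]
  simp only [Real.dist_eq, sq_abs]
  conv_rhs => rw [← Real.sqrt_sq hh, ← Real.sqrt_mul (sq_nonneg h)]
  congr 1
  change ((p.1 : ℝ) * h - q.1 * h) ^ 2 + ((p.2 : ℝ) * h - q.2 * h) ^ 2 = _
  push_cast
  ring

theorem dist_latticePoint_le {h : ℝ} (hh : 0 < h) {ρ : ℝ} (hρ : 0 ≤ ρ) (p q : ℤ × ℤ) :
    dist (latticePoint h p) (latticePoint h q) ≤ h * ρ ↔ Near ρ p q := by
  rw [dist_latticePoint hh.le, mul_le_mul_iff_right₀ hh, Real.sqrt_le_left hρ]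
  rfl

theorem dist_latticePoint_le_of_abs {h B : ℝ} (hh : 0 ≤ h) {p q : ℤ × ℤ}
    (h1 : ((|p.1 - q.1| : ℤ) : ℝ) ≤ B) (h2 : ((|p.2 - q.2| : ℤ) : ℝ) ≤ B) :
    dist (latticePoint h p) (latticePoint h q) ≤ h * (1.4143 * B) := by
  rw [dist_latticePoint hh]
  refine mul_le_mul_of_nonneg_left ?_ hh
  rw [Int.cast_abs] at h1 h2
  have hB : 0 ≤ B := (abs_nonneg _).trans h1
  refine Real.sqrt_le_iff.2 ⟨by positivity, ?_⟩
  have e1 := sq_le_sq' (by linarith [abs_nonneg ((p.1 - q.1 : ℤ) : ℝ)]) h1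
  have e2 := sq_le_sq' (by linarith [abs_nonneg ((p.2 - q.2 : ℤ) : ℝ)]) h2
  rw [sq_abs] at e1 e2
  nlinarith [sq_nonneg B]

theorem abs_le_of_dist_latticePoint {h B : ℝ} (hh : 0 < h) {p q : ℤ × ℤ}
    (hd : dist (latticePoint h p) (latticePoint h q) ≤ h * B) :
    ((|p.1 - q.1| : ℤ) : ℝ) ≤ B ∧ ((|p.2 - q.2| : ℤ) : ℝ) ≤ B := by
  rw [dist_latticePoint hh.le, mul_le_mul_iff_right₀ hh] at hd
  rw [Int.cast_abs, Int.cast_abs]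
  constructor <;> refine le_trans (Real.le_sqrt_of_sq_le ?_) hd <;> rw [sq_abs]
  · linarith [sq_nonneg ((p.2 - q.2 : ℤ) : ℝ)]
  · linarith [sq_nonneg ((p.1 - q.1 : ℤ) : ℝ)]

/-- The number of mesh intervals that fit into `[0, 1]`. -/
def meshCount (η r : ℝ) : ℤ := ⌊1 / (η * r)⌋

/-- The indices of the dense grid points. -/
def denseSet (η : ℝ) (V : Set Plane) (r : ℝ) : Set (ℤ × ℤ) :=
  {q | ((0 ≤ q.1 ∧ q.1 ≤ meshCount η r) ∧ 0 ≤ q.2 ∧ q.2 ≤ meshCount η r) ∧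
    100 ≤ (V ∩ cell η r (latticePoint (η * r) q)).encard}

theorem reducedRadius_eq {η r : ℝ} (hη : η ≠ 0) :
    reducedRadius η r = η * r * latticeRadius η := by
  unfold reducedRadius latticeRadius
  field_simp

section
variable {η r : ℝ} {V : Set Plane}

theorem latticePoint_mem_gridPoints (hh : 0 < η * r) {q : ℤ × ℤ}
    (h1 : 0 ≤ q.1 ∧ q.1 ≤ meshCount η r) (h2 : 0 ≤ q.2 ∧ q.2 ≤ meshCount η r) :
    latticePoint (η * r) q ∈ gridPoints η r := by
  have key : ∀ i : ℤ, 0 ≤ i ∧ i ≤ meshCount η r → (i : ℝ) * (η * r) ∈ Set.Icc (0 : ℝ) 1 := by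
    intro i hi
    have e0 : (0 : ℝ) ≤ i := by exact_mod_cast hi.1
    have e1 := Int.le_floor.1 hi.2
    rw [le_div_iff₀ hh] at e1
    exact ⟨by positivity, e1⟩
  refine ⟨fun i => ?_, fun i => ?_⟩
  · fin_cases i
    · exact key _ h1
    · exact key _ h2
  · fin_cases i
    · exact ⟨q.1, rfl⟩
    · exact ⟨q.2, rfl⟩

theorem exists_index (hh : 0 < η * r) (p : gridPoints η r) :
    ∃ q : ℤ × ℤ, latticePoint (η * r) q = p ∧ (0 ≤ q.1 ∧ q.1 ≤ meshCount η r) ∧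
      0 ≤ q.2 ∧ q.2 ≤ meshCount η r := by
  obtain ⟨p, hp, hk⟩ := p
  obtain ⟨i, hi⟩ := hk 0
  obtain ⟨j, hj⟩ := hk 1
  have key : ∀ i : ℤ, (i : ℝ) * (η * r) ∈ Set.Icc (0 : ℝ) 1 → 0 ≤ i ∧ i ≤ meshCount η r := by
    rintro i ⟨h0, h1⟩
    constructor
    · have := nonneg_of_mul_nonneg_left h0 hh
      exact_mod_cast this
    · exact Int.le_floor.2 ((le_div_iff₀ hh).2 h1)
  refine ⟨(i, j), ?_, key i (hi ▸ hp 0), key j (hj ▸ hp 1)⟩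
  ext k
  fin_cases k
  · exact hi.symm
  · exact hj.symm

theorem index_injective (hh : 0 < η * r) : Function.Injective (latticePoint (η * r)) := by
  intro p q hpq
  have h0 := congrArg (fun z : Plane => z 0) hpq
  have h1 := congrArg (fun z : Plane => z 1) hpq
  simp only [latticePoint_zero, latticePoint_one] at h0 h1
  have h0' := mul_right_cancel₀ hh.ne' h0
  have h1' := mul_right_cancel₀ hh.ne' h1
  exact Prod.ext (by exact_mod_cast h0') (by exact_mod_cast h1')

theorem finite_gridPoints (hh : 0 < η * r) : (gridPoints η r).Finite := by
  refine ((Finset.Icc 0 (meshCount η r) ×ˢ Finset.Icc 0 (meshCount η r)).finite_toSet.image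
    (latticePoint (η * r))).subset ?_
  intro p hp
  obtain ⟨q, hq, h1, h2⟩ := exists_index hh ⟨p, hp⟩
  exact ⟨q, by simp only [Finset.coe_product, Finset.coe_Icc, Set.mem_prod, Set.mem_Icc]; exact ⟨h1, h2⟩, hq⟩

/-- A set of grid points of large but bounded extent has a dense grid point outside it nearby. -/
theorem SparseBound.exists_dense_near (h : SparseBound η (meshCount η r) (denseSet η V r))
    (h0 : 0 < η) (h1 : η < 1 / 1000) (hr : 0 < r)
    (hM : 2 * windowRadius η + 2 ≤ meshCount η r) {C : Set (gridPoints η r)} {c₀ : gridPoints η r}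
    (hc₀ : c₀ ∈ C) (hC : ∀ p ∈ C, dist (p : Plane) c₀ ≤ 1003 * r)
    (hext : ∃ p ∈ C, ∃ q ∈ C, 0.999 * reducedRadius η r ≤ dist (p : Plane) q) :
    ∃ c ∈ C, ∃ s, IsDense η V r s ∧ s ∉ C ∧ dist (s : Plane) c ≤ reducedRadius η r := by
  have hh : 0 < η * r := mul_pos h0 hr
  obtain ⟨hρ, -, -⟩ := latticeRadius_bounds h0 h1
  have hfin : ({q | ∃ p ∈ C, latticePoint (η * r) q = p} : Set (ℤ × ℤ)).Finite := by
    refine ((finite_gridPoints hh).preimage (index_injective hh).injOn).subset ?_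
    rintro q ⟨p, -, hq⟩
    change latticePoint (η * r) q ∈ gridPoints η r
    rw [hq]
    exact p.2
  have hmem : ∀ q, q ∈ hfin.toFinset ↔ ∃ p ∈ C, latticePoint (η * r) q = p := by
    intro q
    rw [Set.Finite.mem_toFinset]
    rfl
  obtain ⟨i₀, hi₀, -⟩ := exists_index hh c₀
  obtain ⟨c, hc, s, hs, hsC, hcs⟩ := h.exists_near h0 h1 hM (C := hfin.toFinset) (c₀ := i₀)
    ((hmem _).2 ⟨c₀, hc₀, hi₀⟩)
    (by
      intro q hq
      obtain ⟨p, -, hp⟩ := (hmem _).1 hq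
      obtain ⟨q', hq', hb⟩ := exists_index hh p
      rw [index_injective hh (hp.trans hq'.symm)]
      exact hb)
    (by
      intro q hq
      obtain ⟨p, hpC, hp⟩ := (hmem _).1 hq
      refine abs_le_of_dist_latticePoint hh ?_
      rw [hp, hi₀]
      refine (hC p hpC).trans (le_of_eq ?_)
      field_simp)
    (by
      obtain ⟨p, hp, q, hq, hpq⟩ := hext
      obtain ⟨i, hi, -⟩ := exists_index hh p
      obtain ⟨j, hj, -⟩ := exists_index hh q
      refine ⟨i, (hmem _).2 ⟨p, hp, hi⟩, j, (hmem _).2 ⟨q, hq, hj⟩, ?_⟩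
      rw [← hi, ← hj, dist_latticePoint hh.le, reducedRadius_eq h0.ne'] at hpq
      have e1 : 0.999 * latticeRadius η ≤
          √(((i.1 - j.1 : ℤ) : ℝ) ^ 2 + ((i.2 - j.2 : ℤ) : ℝ) ^ 2) := by
        refine le_of_mul_le_mul_left ?_ hh
        linarith
      have e2 := (Real.le_sqrt' (by linarith)).1 e1
      nlinarith)
  obtain ⟨p, hpC, hp⟩ := (hmem _).1 hc
  refine ⟨p, hpC, ⟨latticePoint (η * r) s, latticePoint_mem_gridPoints hh hs.1.1 hs.1.2⟩, hs.2,
    fun hmemC => hsC ((hmem _).2 ⟨_, hmemC, rfl⟩), ?_⟩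
  rw [reducedRadius_eq h0.ne', ← hp]
  exact (dist_latticePoint_le hh (by linarith) _ _).2 hcs.symm

/-- `Metric.diam` has the default value 0 on unbounded sets, so bounding distances by it needs this.
-/
theorem isBounded_componentPoints (hh : 0 < η * r) (C : (denseGraph η V r).ConnectedComponent) :
    Bornology.IsBounded (componentPoints C) := by
  refine ((finite_gridPoints hh).subset ?_).isBounded
  rintro _ ⟨p, -, rfl⟩
  exact p.1.2

theorem mem_componentPoints (p : {p | IsDense η V r p}) :
    (p : Plane) ∈ componentPoints ((denseGraph η V r).connectedComponentMk p) :=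
  ⟨p, rfl, rfl⟩

theorem connectedComponentMk_eq_of_dist_le {p q : {p | IsDense η V r p}}
    (h : dist (p : Plane) (q : Plane) ≤ reducedRadius η r) :
    (denseGraph η V r).connectedComponentMk p = (denseGraph η V r).connectedComponentMk q := by
  by_cases hpq : p = q
  · rw [hpq]
  · refine SimpleGraph.ConnectedComponent.connectedComponentMk_eq_of_adj ?_
    exact ⟨fun h => hpq (Subtype.ext h), h⟩

/-- The grid points of a component of the dense graph. -/
def componentVertices (C : (denseGraph η V r).ConnectedComponent) : Set (gridPoints η r) :=
  {p | ∃ hp : IsDense η V r p, (denseGraph η V r).connectedComponentMk ⟨p, hp⟩ = C}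

theorem exists_mem_componentVertices {C : (denseGraph η V r).ConnectedComponent} {x : Plane}
    (hx : x ∈ componentPoints C) : ∃ p ∈ componentVertices C, (p : Plane) = x := by
  obtain ⟨p, hp, rfl⟩ := hx
  exact ⟨p.1, ⟨p.2, hp⟩, rfl⟩

theorem dist_le_geomDiam (hh : 0 < η * r) {C : (denseGraph η V r).ConnectedComponent}
    {p q : gridPoints η r} (hp : p ∈ componentVertices C) (hq : q ∈ componentVertices C) :
    dist (p : Plane) q ≤ geomDiam C := by
  obtain ⟨hp, hpC⟩ := hp
  obtain ⟨hq, hqC⟩ := hq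
  exact Metric.dist_le_diam_of_mem (isBounded_componentPoints hh C) ⟨⟨p, hp⟩, hpC, rfl⟩
    ⟨⟨q, hq⟩, hqC, rfl⟩

theorem mem_componentVertices_of_dist_le {C : (denseGraph η V r).ConnectedComponent}
    {p q : gridPoints η r} (hp : p ∈ componentVertices C) (hq : IsDense η V r q)
    (h : dist (q : Plane) p ≤ reducedRadius η r) : q ∈ componentVertices C := by
  obtain ⟨hp, hpC⟩ := hp
  exact ⟨hq, (connectedComponentMk_eq_of_dist_le (p := ⟨q, hq⟩) (q := ⟨p, hp⟩) h).trans hpC⟩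

theorem exists_far_of_le_diam {C : (denseGraph η V r).ConnectedComponent} {B : ℝ} (hB : 0 ≤ B)
    (h : B < geomDiam C) : ∃ p ∈ componentVertices C, ∃ q ∈ componentVertices C,
      B < dist (p : Plane) (q : Plane) := by
  by_contra! hcon
  refine absurd h (not_lt.2 (Metric.diam_le_of_forall_dist_le hB ?_))
  intro x hx y hy
  obtain ⟨p, hp, rfl⟩ := exists_mem_componentVertices hx
  obtain ⟨q, hq, rfl⟩ := exists_mem_componentVertices hy
  exact hcon p hp q hq

theorem reducedRadius_bounds (h0 : 0 < η) (h1 : η < 1 / 1000) (hr : 0 < r) :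
    0 < reducedRadius η r ∧ reducedRadius η r < r := by
  obtain ⟨hρ, hρ', -⟩ := latticeRadius_bounds h0 h1
  have hh : 0 < η * r := mul_pos h0 hr
  rw [reducedRadius_eq h0.ne']
  refine ⟨mul_pos hh (by linarith), ?_⟩
  calc η * r * latticeRadius η < η * r * (1 / η) := by gcongr
    _ = r := by field_simp

theorem SparseBound.small_or_large (h : SparseBound η (meshCount η r) (denseSet η V r))
    (h0 : 0 < η) (h1 : η < 1 / 1000) (hr : 0 < r)
    (hM : 2 * windowRadius η + 2 ≤ meshCount η r) (C : (denseGraph η V r).ConnectedComponent) :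
    geomDiam C < reducedRadius η r ∨ 1000 * r < geomDiam C := by
  by_contra! hcon
  have hh := mul_pos h0 hr
  obtain ⟨hρ0, hρr⟩ := reducedRadius_bounds h0 h1 hr
  -- The factor 0.999 makes the lower bound on the diameter strict; its square still exceeds the
  -- 0.998 of `exists_near`.
  obtain ⟨p, hp, q, hq, hpq⟩ := exists_far_of_le_diam (C := C) (B := 0.999 * reducedRadius η r)
    (by positivity) (by linarith)
  obtain ⟨c, hc, s, hs, hsC, hcs⟩ := h.exists_dense_near h0 h1 hr hM hp
    (fun x hx => (dist_le_geomDiam hh hx hp).trans (by linarith)) ⟨p, hp, q, hq, hpq.le⟩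
  exact hsC (mem_componentVertices_of_dist_le hc hs hcs)

theorem SparseBound.small_far_small (h : SparseBound η (meshCount η r) (denseSet η V r))
    (h0 : 0 < η) (h1 : η < 1 / 1000) (hr : 0 < r)
    (hM : 2 * windowRadius η + 2 ≤ meshCount η r) (C₁ C₂ : (denseGraph η V r).ConnectedComponent)
    (hne : C₁ ≠ C₂) (hC₁ : geomDiam C₁ < reducedRadius η r)
    (hC₂ : geomDiam C₂ < reducedRadius η r) :
    ∀ p₁ ∈ componentPoints C₁, ∀ p₂ ∈ componentPoints C₂, 1000 * r < dist p₁ p₂ := by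
  intro x hx y hy
  obtain ⟨p, hp, rfl⟩ := exists_mem_componentVertices hx
  obtain ⟨q, hq, rfl⟩ := exists_mem_componentVertices hy
  by_contra! hcon
  have hh := mul_pos h0 hr
  obtain ⟨hρ0, hρr⟩ := reducedRadius_bounds h0 h1 hr
  have hfar : reducedRadius η r < dist (p : Plane) q := by
    by_contra! hlt
    obtain ⟨_, h2⟩ := mem_componentVertices_of_dist_le hq hp.1 hlt
    exact hne (hp.2.symm.trans h2)
  obtain ⟨c, hc, s, hs, hsC, hcs⟩ := h.exists_dense_near h0 h1 hr hM
    (C := componentVertices C₁ ∪ componentVertices C₂) (c₀ := p) (Or.inl hp)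
    (by
      rintro x (hx | hx)
      · exact (dist_le_geomDiam hh hx hp).trans (by linarith)
      · have e1 := dist_le_geomDiam hh hx hq
        have e2 := dist_triangle (x : Plane) (q : Plane) (p : Plane)
        rw [dist_comm (q : Plane)] at e2
        linarith)
    ⟨p, Or.inl hp, q, Or.inr hq, by linarith⟩
  rcases hc with hc | hc
  · exact hsC (Or.inl (mem_componentVertices_of_dist_le hc hs hcs))
  · exact hsC (Or.inr (mem_componentVertices_of_dist_le hc hs hcs))

theorem SparseBound.small_far_bad (h : SparseBound η (meshCount η r) (denseSet η V r))
    (h0 : 0 < η) (h1 : η < 1 / 1000) (hr : 0 < r)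
    (hM : 2 * windowRadius η + 2 ≤ meshCount η r) (C : (denseGraph η V r).ConnectedComponent)
    (hC : geomDiam C < reducedRadius η r) :
    ∀ p₁ ∈ componentPoints C, ∀ p₂ : {p | IsBad η V r p}, 1000 * r < dist p₁ (p₂ : Plane) := by
  rintro x hx ⟨q, hq⟩
  obtain ⟨p, hp, rfl⟩ := exists_mem_componentVertices hx
  dsimp only
  by_contra! hcon
  have hh := mul_pos h0 hr
  obtain ⟨hρ0, hρr⟩ := reducedRadius_bounds h0 h1 hr
  -- A bad vertex can be added to the set: no dense vertex is near it, in particular not `p`.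
  obtain ⟨c, hc, s, hs, hsC, hcs⟩ := h.exists_dense_near h0 h1 hr hM
    (C := componentVertices C ∪ {q}) (c₀ := p) (Or.inl hp)
    (by
      rintro x (hx | rfl)
      · exact (dist_le_geomDiam hh hx hp).trans (by linarith)
      · rw [dist_comm]
        linarith)
    ⟨p, Or.inl hp, q, Or.inr rfl, by
      by_contra! hlt
      exact hq p (by rw [Metric.mem_closedBall]; linarith) hp.1⟩
  rcases hc with hc | rfl
  · exact hsC (Or.inl (mem_componentVertices_of_dist_le hc hs hcs))
  · exact hq s hcs hs

theorem SparseBound.bad_near_or_far (h : SparseBound η (meshCount η r) (denseSet η V r))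
    (h0 : 0 < η) (h1 : η < 1 / 1000) (hr : 0 < r)
    (hM : 2 * windowRadius η + 2 ≤ meshCount η r) (p q : {p | IsBad η V r p}) :
    dist (p : Plane) (q : Plane) < reducedRadius η r ∨
      1000 * r < dist (p : Plane) (q : Plane) := by
  by_contra! hcon
  obtain ⟨hρ0, hρr⟩ := reducedRadius_bounds h0 h1 hr
  obtain ⟨c, hc, s, hs, hsC, hcs⟩ := h.exists_dense_near h0 h1 hr hM
    (C := {p.1, q.1}) (c₀ := p) (Or.inl rfl)
    (by
      rintro _ (rfl | rfl)
      · rw [dist_self]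
        positivity
      · rw [dist_comm]
        linarith)
    ⟨p, Or.inl rfl, q, Or.inr rfl, by linarith⟩
  rcases hc with rfl | rfl
  · exact p.2 s hcs hs
  · exact q.2 s hcs hs

theorem exists_dense_index (hh : 0 < η * r) (p : {p | IsDense η V r p}) :
    ∃ q ∈ denseSet η V r, latticePoint (η * r) q = (p : Plane) := by
  obtain ⟨q, hq, hb⟩ := exists_index hh p.1
  refine ⟨q, ⟨hb, ?_⟩, hq⟩
  rw [hq]
  exact p.2

theorem exists_of_mem_denseSet (hh : 0 < η * r) {q : ℤ × ℤ} (hq : q ∈ denseSet η V r) :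
    ∃ p : {p | IsDense η V r p}, latticePoint (η * r) q = (p : Plane) :=
  ⟨⟨⟨_, latticePoint_mem_gridPoints hh hq.1.1 hq.1.2⟩, hq.2⟩, rfl⟩

/-- Chains of dense lattice points give walks in the dense graph. -/
theorem Joined.exists_walk (h0 : 0 < η) (h1 : η < 1 / 1000) (hr : 0 < r) {W : Set (ℤ × ℤ)}
    {i j : ℤ × ℤ} (hij : Joined (latticeRadius η) (denseSet η V r ∩ W) i j)
    {p q : {p | IsDense η V r p}} (hp : latticePoint (η * r) i = (p : Plane)) (hiW : i ∈ W)
    (hq : latticePoint (η * r) j = (q : Plane)) :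
    ∃ w : (denseGraph η V r).Walk p q, ∀ x ∈ w.support, ∃ k ∈ W,
      k ∈ denseSet η V r ∧ latticePoint (η * r) k = (x : Plane) := by
  have hh := mul_pos h0 hr
  obtain ⟨hρ, -, -⟩ := latticeRadius_bounds h0 h1
  induction hij generalizing q with
  | refl =>
    have hpq : p = q := Subtype.ext (Subtype.ext (hp.symm.trans hq))
    subst hpq
    refine ⟨SimpleGraph.Walk.nil, fun x hx => ?_⟩
    rw [SimpleGraph.Walk.support_nil, List.mem_singleton] at hx
    subst hx
    obtain ⟨k, hk, hk'⟩ := exists_dense_index hh x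
    have := index_injective hh (hk'.trans hp.symm)
    subst this
    exact ⟨k, hiW, hk, hk'⟩
  | @tail b c _ hbc ih =>
    obtain ⟨x, hx⟩ := exists_of_mem_denseSet hh hbc.1.1
    obtain ⟨w, hw⟩ := ih hx
    by_cases hxq : x = q
    · subst hxq
      exact ⟨w, hw⟩
    · have hadj : (denseGraph η V r).Adj x q := by
        refine ⟨fun h => hxq (Subtype.ext h), ?_⟩
        change dist (x : Plane) (q : Plane) ≤ _
        rw [← hx, ← hq, reducedRadius_eq h0.ne']
        exact (dist_latticePoint_le hh (by linarith) _ _).2 hbc.2.2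
      refine ⟨w.concat hadj, fun y hy => ?_⟩
      rw [SimpleGraph.Walk.support_concat, List.mem_append,
        List.mem_singleton] at hy
      rcases hy with hy | rfl
      · exact hw y hy
      · exact ⟨c, hbc.2.1.2, hbc.2.1.1, hq⟩

theorem Joined.reachable (h0 : 0 < η) (h1 : η < 1 / 1000) (hr : 0 < r)
    {i j : ℤ × ℤ} (hij : Joined (latticeRadius η) (denseSet η V r) i j)
    {p q : {p | IsDense η V r p}} (hp : latticePoint (η * r) i = (p : Plane))
    (hq : latticePoint (η * r) j = (q : Plane)) :
    (denseGraph η V r).connectedComponentMk p = (denseGraph η V r).connectedComponentMk q := by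
  obtain ⟨w, -⟩ := Joined.exists_walk h0 h1 hr (W := Set.univ) (by simpa using hij) hp trivial hq
  exact SimpleGraph.ConnectedComponent.sound ⟨w⟩

theorem joined_of_reachable (h0 : 0 < η) (h1 : η < 1 / 1000) (hr : 0 < r)
    {i j : ℤ × ℤ} {p q : {p | IsDense η V r p}} (hpq : (denseGraph η V r).connectedComponentMk p =
      (denseGraph η V r).connectedComponentMk q)
    (hp : latticePoint (η * r) i = (p : Plane)) (hq : latticePoint (η * r) j = (q : Plane)) :
    Joined (latticeRadius η) (denseSet η V r) i j := by
  have hh := mul_pos h0 hr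
  obtain ⟨hρ, -, -⟩ := latticeRadius_bounds h0 h1
  obtain ⟨w⟩ := SimpleGraph.ConnectedComponent.exact hpq
  induction w generalizing i with
  | nil =>
    rw [index_injective hh (hp.trans hq.symm)]
    exact Relation.ReflTransGen.refl
  | @cons u v _ huv w ih =>
    obtain ⟨k, hk, hk'⟩ := exists_dense_index hh v
    obtain ⟨l, hl, hl'⟩ := exists_dense_index hh u
    have := index_injective hh (hp.trans hl'.symm)
    subst this
    refine (Joined.single hl hk ?_).trans (ih (SimpleGraph.ConnectedComponent.sound ⟨w⟩) hk' hq)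
    rw [← dist_latticePoint_le hh (by linarith), hp, hk', ← reducedRadius_eq h0.ne']
    exact huv.2

theorem abs_sub_le_of_coarse {M m i j k : ℤ} (hm : 1 ≤ m) (hi : i ≤ M) (hj : j ≤ M)
    (h : |coarse M m i - coarse M m j| ≤ k) : |i - j| ≤ (k + 2) * m := by
  have h1 := coarse_bounds hm hi
  have h2 := coarse_bounds hm hj
  rw [abs_le] at h ⊢
  constructor <;> nlinarith

theorem dist_le_of_coarse (h0 : 0 < η) (h1 : η < 1 / 1000) (hr : 0 < r) {i j : ℤ × ℤ} {k : ℤ}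
    (hi : i ∈ denseSet η V r) (hj : j ∈ denseSet η V r)
    (hc1 : |coarse (meshCount η r) (coarseSide η) i.1 -
      coarse (meshCount η r) (coarseSide η) j.1| ≤ k)
    (hc2 : |coarse (meshCount η r) (coarseSide η) i.2 -
      coarse (meshCount η r) (coarseSide η) j.2| ≤ k) :
    dist (latticePoint (η * r) i) (latticePoint (η * r) j) ≤ (k + 2) * 0.495005 * r := by
  have hh := mul_pos h0 hr
  obtain ⟨-, -, hm3, hm⟩ := coarseSide_bounds h0 h1
  have e1 := abs_sub_le_of_coarse hm hi.1.1.2 hj.1.1.2 hc1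
  have e2 := abs_sub_le_of_coarse hm hi.1.2.2 hj.1.2.2 hc2
  have hk : (0 : ℝ) ≤ k + 2 := by
    have := (abs_nonneg _).trans hc1
    exact_mod_cast (by omega : (0 : ℤ) ≤ k + 2)
  refine (dist_latticePoint_le_of_abs (B := (k + 2) * (0.35 / η)) hh.le ?_ ?_).trans (le_of_eq ?_)
  · refine le_trans (Int.cast_le.2 e1) ?_
    push_cast
    gcongr
  · refine le_trans (Int.cast_le.2 e2) ?_
    push_cast
    gcongr
  · field_simp
    ring

theorem coarse_index_range (hm : 1 ≤ coarseSide η) (hM : 1 ≤ meshCount η r / coarseSide η)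
    {i : ℤ × ℤ} (hi : i ∈ denseSet η V r) :
    (0 ≤ coarse (meshCount η r) (coarseSide η) i.1 ∧
      coarse (meshCount η r) (coarseSide η) i.1 < meshCount η r / coarseSide η) ∧
    (0 ≤ coarse (meshCount η r) (coarseSide η) i.2 ∧
      coarse (meshCount η r) (coarseSide η) i.2 < meshCount η r / coarseSide η) :=
  ⟨coarse_range hm hM hi.1.1.1, coarse_range hm hM hi.1.2.1⟩

/-- A point of a component of large diameter is joined to the good lines near a close centre. -/
theorem SparseBound.joined_goodLines_of_large
    (h : SparseBound η (meshCount η r) (denseSet η V r))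
    (h0 : 0 < η) (h1 : η < 1 / 1000) (hr : 0 < r)
    (hM : 2 * windowRadius η + 2 ≤ meshCount η r) {p : {p | IsDense η V r p}}
    (hp : ¬geomDiam ((denseGraph η V r).connectedComponentMk p) < reducedRadius η r)
    {i c : ℤ × ℤ} (hi : i ∈ denseSet η V r) (hip : latticePoint (η * r) i = (p : Plane))
    (hc1 : 0 ≤ c.1 ∧ c.1 < meshCount η r / coarseSide η)
    (hc2 : 0 ≤ c.2 ∧ c.2 < meshCount η r / coarseSide η)
    (hic1 : |coarse (meshCount η r) (coarseSide η) i.1 - c.1| ≤ 80)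
    (hic2 : |coarse (meshCount η r) (coarseSide η) i.2 - c.2| ≤ 80) :
    ∃ z ∈ goodLines (meshCount η r) (coarseSide η) (denseSet η V r) c,
      Joined (latticeRadius η)
        (denseSet η V r ∩ coarseWindow (meshCount η r) (coarseSide η) c) i z := by
  have hh := mul_pos h0 hr
  have hlarge := (h.small_or_large h0 h1 hr hM _).resolve_left hp
  have hN := h.nearlyFull h0 h1 hM
  obtain ⟨x, ⟨hxD, hx⟩, y, ⟨hyD, hy⟩, hxy⟩ := exists_far_of_le_diam (by positivity) hlarge
  obtain ⟨j, hj, hjx⟩ := exists_dense_index hh ⟨x, hxD⟩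
  obtain ⟨k, hk, hky⟩ := exists_dense_index hh ⟨y, hyD⟩
  have hij := joined_of_reachable h0 h1 hr hx.symm hip hjx
  have hik := joined_of_reachable h0 h1 hr hy.symm hip hky
  by_cases hjw : j ∈ coarseWindow (meshCount η r) (coarseSide η) c
  · by_cases hkw : k ∈ coarseWindow (meshCount η r) (coarseSide η) c
    · exfalso
      simp only [coarseWindow, Set.mem_ofPred_eq, abs_le] at hjw hkw
      -- Two points in the window are at distance at most 402 · 0.495005r < 1000r, so a large
      -- component leaves it.
      have := dist_le_of_coarse h0 h1 hr (k := 400) hj hk (by rw [abs_le]; omega)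
        (by rw [abs_le]; omega)
      rw [hjx, hky] at this
      push_cast at this
      linarith
    · exact hN.joined_goodLines_of_exit hc1 hc2 hi hic1 hic2 hik hkw
  · exact hN.joined_goodLines_of_exit hc1 hc2 hi hic1 hic2 hij hjw

theorem SparseBound.locally_connected (h : SparseBound η (meshCount η r) (denseSet η V r))
    (h0 : 0 < η) (h1 : η < 1 / 1000) (hr : 0 < r)
    (hM : 2 * windowRadius η + 2 ≤ meshCount η r) (p₁ p₂ : {p | IsDense η V r p})
    (hd : dist (p₁ : Plane) (p₂ : Plane) < 25 * r)
    (hp₁ : ¬geomDiam ((denseGraph η V r).connectedComponentMk p₁) < reducedRadius η r)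
    (hp₂ : ¬geomDiam ((denseGraph η V r).connectedComponentMk p₂) < reducedRadius η r) :
    ∃ w : (denseGraph η V r).Walk p₁ p₂, w.IsPath ∧
      ∀ q ∈ w.support, (q : Plane) ∈ Metric.closedBall (p₁ : Plane) (100 * r) := by
  classical
  have hh := mul_pos h0 hr
  have hN := h.nearlyFull h0 h1 hM
  have hlarge := hN.large
  obtain ⟨-, hm2, -, hm⟩ := coarseSide_bounds h0 h1
  obtain ⟨i, hi, hip⟩ := exists_dense_index hh p₁
  obtain ⟨j, hj, hjp⟩ := exists_dense_index hh p₂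
  obtain ⟨hc1, hc2⟩ := coarse_index_range hm (by omega) hi
  have hdist : dist (latticePoint (η * r) j) (latticePoint (η * r) i) ≤ (η * r) * (25 / η) := by
    rw [hip, hjp, dist_comm]
    refine hd.le.trans (le_of_eq ?_)
    field_simp
  have habs := abs_le_of_dist_latticePoint hh hdist
  -- A coarse side is at least 0.33/η and 80 · 0.33 > 25, so `p₂` has coarse offset at most 80 from
  -- `p₁`.
  have hcast : ∀ x : ℤ, (x : ℝ) ≤ 25 / η → x ≤ 80 * coarseSide η := by
    intro x hx
    have e1 : (25 / η : ℝ) ≤ 80 * (0.33 / η) := by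
      rw [← mul_div_assoc]
      gcongr
      norm_num
    have e2 : (x : ℝ) ≤ ((80 * coarseSide η : ℤ) : ℝ) := by
      push_cast
      linarith
    exact_mod_cast e2
  set c : ℤ × ℤ := (coarse (meshCount η r) (coarseSide η) i.1,
    coarse (meshCount η r) (coarseSide η) i.2) with hc
  obtain ⟨z₁, hz₁, hiz⟩ := h.joined_goodLines_of_large h0 h1 hr hM hp₁ hi hip (c := c) hc1 hc2
    (by simp [hc]) (by simp [hc])
  obtain ⟨z₂, hz₂, hjz⟩ := h.joined_goodLines_of_large h0 h1 hr hM hp₂ hj hjp (c := c) hc1 hc2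
    (abs_coarse_sub_le hm (hcast _ habs.1)) (abs_coarse_sub_le hm (hcast _ habs.2))
  have hij := (hiz.trans (hN.joined_goodLines hc1 hc2 hz₁ hz₂)).trans hjz.symm
  obtain ⟨w, hw⟩ := hij.exists_walk h0 h1 hr hip (by simp [coarseWindow, hc]) hjp
  refine ⟨w.bypass, w.bypass_isPath, fun q hq => ?_⟩
  obtain ⟨k, hkW, hkD, hkq⟩ := hw q (w.support_bypass_subset_support hq)
  -- Window radius 200 fits the disc: 202 · 0.495005 < 100.
  have := dist_le_of_coarse h0 h1 hr hkD hi hkW.1 hkW.2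
  rw [hkq, hip] at this
  rw [Metric.mem_closedBall]
  push_cast at this
  linarith

theorem SparseBound.unique_large (h : SparseBound η (meshCount η r) (denseSet η V r))
    (h0 : 0 < η) (h1 : η < 1 / 1000) (hr : 0 < r)
    (hM : 2 * windowRadius η + 2 ≤ meshCount η r) :
    ∃! C : (denseGraph η V r).ConnectedComponent, reducedRadius η r ≤ geomDiam C := by
  have hh := mul_pos h0 hr
  have hN := h.nearlyFull h0 h1 hM
  have hlarge := hN.large
  obtain ⟨hρ, -, -⟩ := latticeRadius_bounds h0 h1
  obtain ⟨-, -, -, hm⟩ := coarseSide_bounds h0 h1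
  obtain ⟨a, ha, b, hb, hab⟩ := hN.exists_joined_far
  have hz : 0 ≤ (0 : ℤ) ∧ 0 < meshCount η r / coarseSide η := ⟨le_rfl, by omega⟩
  obtain ⟨p, hp⟩ := exists_of_mem_denseSet hh ha.1
  obtain ⟨q, hq⟩ := exists_of_mem_denseSet hh hb.1
  have hpq := ((hN.joined_goodLines (c := (0, 0)) hz hz ha hb).mono Set.inter_subset_left).reachable h0 h1 hr hp hq
  refine ⟨(denseGraph η V r).connectedComponentMk p, ?_, ?_⟩
  · have e1 : dist (p : Plane) (q : Plane) ≤
        geomDiam ((denseGraph η V r).connectedComponentMk p) :=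
      Metric.dist_le_diam_of_mem (isBounded_componentPoints hh _) (mem_componentPoints p)
        (by rw [hpq]; exact mem_componentPoints q)
    refine le_trans ?_ e1
    by_contra! hlt
    rw [← hp, ← hq, reducedRadius_eq h0.ne', dist_comm] at hlt
    have := (abs_le_of_dist_latticePoint hh hlt.le).1
    rw [Int.cast_abs] at this
    linarith [le_abs_self (((b.1 - a.1 : ℤ) : ℝ))]
  · intro C hC
    induction C using SimpleGraph.ConnectedComponent.ind with
    | _ x =>
      obtain ⟨i, hi, hix⟩ := exists_dense_index hh x
      obtain ⟨hc1, hc2⟩ := coarse_index_range hm (by omega) hi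
      obtain ⟨z, hz₁, hiz⟩ := h.joined_goodLines_of_large h0 h1 hr hM (not_lt.2 hC) hi hix
        (c := (coarse (meshCount η r) (coarseSide η) i.1,
          coarse (meshCount η r) (coarseSide η) i.2)) hc1 hc2 (by simp) (by simp)
      exact ((hiz.mono Set.inter_subset_left).trans
        (hN.joined_goodLines_global (c' := (0, 0)) hc1 hc2 hz hz hz₁ ha)).reachable h0 h1 hr hix hp

/-- The six structural properties follow from bounds on the numbers of sparse cells in windows. -/
theorem SparseBound.goodStructure (h : SparseBound η (meshCount η r) (denseSet η V r))
    (h0 : 0 < η) (h1 : η < 1 / 1000) (hr : 0 < r)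
    (hM : 2 * windowRadius η + 2 ≤ meshCount η r) : GoodStructure η V r where
  small_or_large := h.small_or_large h0 h1 hr hM
  small_far_small := h.small_far_small h0 h1 hr hM
  small_far_bad := h.small_far_bad h0 h1 hr hM
  bad_near_or_far := h.bad_near_or_far h0 h1 hr hM
  locally_connected := h.locally_connected h0 h1 hr hM
  unique_large := h.unique_large h0 h1 hr hM

end

/-! ### Areas of unions of cells and the Chernoff bound. -/

theorem cell_eq_preimage (η r : ℝ) (p : Plane) : cell η r p =
    (WithLp.ofLp : Plane → Fin 2 → ℝ) ⁻¹'
      (Set.univ.pi fun i => Set.Ico (p i) (p i + η * r)) := by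
  ext z
  simp [cell]

theorem measurableSet_cell (η r : ℝ) (p : Plane) : MeasurableSet (cell η r p) := by
  rw [cell_eq_preimage]
  exact (PiLp.volume_preserving_ofLp (Fin 2)).measurable
    (MeasurableSet.univ_pi fun _ => measurableSet_Ico)

theorem volume_cell {η r : ℝ} (hh : 0 ≤ η * r) (p : Plane) :
    volume (cell η r p) = ENNReal.ofReal ((η * r) ^ 2) := by
  rw [cell_eq_preimage, (PiLp.volume_preserving_ofLp (Fin 2)).measure_preimage
    (MeasurableSet.univ_pi fun _ => measurableSet_Ico).nullMeasurableSet, Real.volume_pi_Ico]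
  simp only [add_sub_cancel_left, Fin.prod_univ_two]
  rw [← ENNReal.ofReal_mul hh, sq]

theorem volume_unitSquare : volume unitSquare = 1 := by
  have : unitSquare = (WithLp.ofLp : Plane → Fin 2 → ℝ) ⁻¹'
      (Set.univ.pi fun _ => Set.Icc (0 : ℝ) 1) := by
    ext z
    simp only [unitSquare, Set.mem_ofPred_eq, Set.mem_preimage, Set.mem_univ_pi]
  rw [this, (PiLp.volume_preserving_ofLp (Fin 2)).measure_preimage
    (MeasurableSet.univ_pi fun _ => measurableSet_Icc).nullMeasurableSet, volume_pi_pi]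
  simp

theorem index_eq_of_mem_cell {η r : ℝ} (hh : 0 < η * r) {s : ℤ × ℤ} {z : Plane}
    (hz : z ∈ cell η r (latticePoint (η * r) s)) :
    s = (⌊z 0 / (η * r)⌋, ⌊z 1 / (η * r)⌋) := by
  have h0 := hz 0
  have h1 := hz 1
  simp only [latticePoint_zero, latticePoint_one, Set.mem_Ico] at h0 h1
  refine Prod.ext ?_ ?_ <;> symm <;> rw [Int.floor_eq_iff] <;> constructor
  · rw [le_div_iff₀ hh]; exact h0.1
  · rw [div_lt_iff₀ hh]; linarith [h0.2]
  · rw [le_div_iff₀ hh]; exact h1.1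
  · rw [div_lt_iff₀ hh]; linarith [h1.2]

/-- The union of the cells with indices in `S`. -/
def cellUnion (η r : ℝ) (S : Finset (ℤ × ℤ)) : Set Plane :=
  ⋃ s ∈ S, cell η r (latticePoint (η * r) s)

theorem measurableSet_cellUnion (η r : ℝ) (S : Finset (ℤ × ℤ)) :
    MeasurableSet (cellUnion η r S) :=
  Finset.measurableSet_biUnion _ fun _ _ => measurableSet_cell _ _ _

theorem volume_cellUnion {η r : ℝ} (hh : 0 < η * r) (S : Finset (ℤ × ℤ)) :
    volume (cellUnion η r S) = ENNReal.ofReal (S.card * (η * r) ^ 2) := by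
  unfold cellUnion
  rw [measure_biUnion_finset]
  · simp only [volume_cell hh.le, Finset.sum_const, nsmul_eq_mul]
    rw [ENNReal.ofReal_mul (by positivity), ENNReal.ofReal_natCast]
  · intro s _ t _ hst
    refine Set.disjoint_left.2 fun z hs ht => hst ?_
    rw [index_eq_of_mem_cell hh hs, index_eq_of_mem_cell hh ht]
  · exact fun _ _ => measurableSet_cell _ _ _

theorem cellUnion_subset_unitSquare {η r : ℝ} (hh : 0 < η * r) {S : Finset (ℤ × ℤ)}
    (hS : ∀ s ∈ S, (0 ≤ s.1 ∧ s.1 < meshCount η r) ∧ 0 ≤ s.2 ∧ s.2 < meshCount η r) :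
    cellUnion η r S ⊆ unitSquare := by
  have key : ∀ (i : ℤ) (x : ℝ), 0 ≤ i ∧ i < meshCount η r →
      x ∈ Set.Ico ((i : ℝ) * (η * r)) ((i : ℝ) * (η * r) + η * r) → x ∈ Set.Icc (0 : ℝ) 1 := by
    intro i x hi hx
    have e0 : (0 : ℝ) ≤ i := by exact_mod_cast hi.1
    have e1 : ((i + 1 : ℤ) : ℝ) ≤ 1 / (η * r) := Int.le_floor.1 (by have := hi.2; unfold meshCount at this; omega)
    rw [le_div_iff₀ hh] at e1
    push_cast at e1
    exact ⟨le_trans (by positivity) hx.1, by linarith [hx.2]⟩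
  intro z hz
  obtain ⟨s, hs, hz⟩ := Set.mem_iUnion₂.1 hz
  intro i
  fin_cases i
  · exact key _ _ (hS s hs).1 (hz 0)
  · exact key _ _ (hS s hs).2 (hz 1)

/-- Indices strictly below `meshCount` give cells inside the unit square, so no area is lost. This
is why windows omit the last index although grid points may have it. -/
theorem measureReal_preimage_cellUnion {Ω : Type*} [MeasurableSpace Ω] {μ : Measure Ω} {X : Ω → Plane}
    (hu : pdf.IsUniform X unitSquare μ volume) {η r : ℝ} (hh : 0 < η * r) {S : Finset (ℤ × ℤ)}
    (hS : ∀ s ∈ S, (0 ≤ s.1 ∧ s.1 < meshCount η r) ∧ 0 ≤ s.2 ∧ s.2 < meshCount η r) :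
    μ.real (X ⁻¹' cellUnion η r S) = S.card * (η * r) ^ 2 := by
  rw [measureReal_def, pdf.IsUniform.measure_preimage (by rw [volume_unitSquare]; simp)
    (by rw [volume_unitSquare]; simp) hu (measurableSet_cellUnion _ _ _),
    Set.inter_eq_self_of_subset_right (cellUnion_subset_unitSquare hh hS), volume_unitSquare,
    div_one, volume_cellUnion hh, ENNReal.toReal_ofReal (by positivity)]

section
variable {Ω : Type*} [MeasurableSpace Ω] {μ : Measure Ω} [IsProbabilityMeasure μ]

/-- Chernoff bound: few of `n` independent points lie in a set only with small probability. -/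
theorem measureReal_card_le_le {E : Type*} [MeasurableSpace E] {X : ℕ → Ω → E}
    (hm : ∀ i, Measurable (X i)) (hi : iIndepFun X μ) {U : Set E} [DecidablePred (· ∈ U)]
    (hU : MeasurableSet U) {a : ℝ} (ha : ∀ i, μ.real (X i ⁻¹' U) = a) (n K : ℕ) :
    μ.real {ω | ((Finset.range n).filter fun i => X i ω ∈ U).card ≤ K} ≤
      Real.exp (5 * K) * Real.exp (-(n * a * (1 - Real.exp (-5)))) := by
  let g : E → ℝ := U.indicator 1
  have hg : Measurable g := measurable_const.indicator hU
  let Y : ℕ → Ω → ℝ := fun i => g ∘ X i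
  have hY : ∀ i, Measurable (Y i) := fun i => hg.comp (hm i)
  have hYi : iIndepFun Y μ := hi.comp (fun _ => g) fun _ => hg
  have hset : {ω | ((Finset.range n).filter fun i => X i ω ∈ U).card ≤ K} =
      {ω | (∑ i ∈ Finset.range n, Y i) ω ≤ (K : ℝ)} := by
    ext ω
    simp only [Set.mem_ofPred_eq, Finset.sum_apply, Y, g, Function.comp_apply, Set.indicator_apply,
      Pi.one_apply, Finset.sum_boole, Nat.cast_le]
  have hmeas : Measurable (∑ i ∈ Finset.range n, Y i) := by
    have := Finset.measurable_sum (Finset.range n) fun i _ => hY i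
    convert this using 1
    ext ω
    simp
  have hnonneg : ∀ ω, 0 ≤ (∑ i ∈ Finset.range n, Y i) ω := by
    intro ω
    rw [Finset.sum_apply]
    exact Finset.sum_nonneg fun i _ => Set.indicator_nonneg (fun _ _ => zero_le_one) _
  have hint : Integrable (fun ω => Real.exp (-5 * (∑ i ∈ Finset.range n, Y i) ω)) μ := by
    refine Integrable.of_bound (C := 1) (by fun_prop) (Eventually.of_forall fun ω => ?_)
    rw [Real.norm_eq_abs, Real.abs_exp, Real.exp_le_one_iff]
    linarith [hnonneg ω]
  -- The transform of an indicator is 1 − a(1 − e⁻⁵), and 1 + x ≤ eˣ.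
  have hmgf : ∀ i, mgf (Y i) μ (-5) ≤ Real.exp (-(a * (1 - Real.exp (-5)))) := by
    intro i
    have hpre : MeasurableSet (X i ⁻¹' U) := hm i hU
    have heq : (fun ω => Real.exp (-5 * Y i ω)) =
        fun ω => 1 + (X i ⁻¹' U).indicator (fun _ => Real.exp (-5) - 1) ω := by
      ext ω
      by_cases h : X i ω ∈ U
      · simp [Y, g, h]
      · simp [Y, g, h]
    unfold mgf
    rw [heq, integral_add (integrable_const _) ((integrable_const _).indicator hpre),
      integral_indicator_const _ hpre, ha]
    simp only [integral_const, probReal_univ, smul_eq_mul, one_mul]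
    have := Real.add_one_le_exp (-(a * (1 - Real.exp (-5))))
    linarith
  rw [hset]
  refine (measure_le_le_exp_mul_mgf (t := -5) (K : ℝ) (by norm_num) hint).trans ?_
  rw [neg_neg, hYi.mgf_sum hY]
  refine mul_le_mul_of_nonneg_left ?_ (Real.exp_pos _).le
  calc ∏ i ∈ Finset.range n, mgf (Y i) μ (-5)
      ≤ ∏ _i ∈ Finset.range n, Real.exp (-(a * (1 - Real.exp (-5)))) :=
        Finset.prod_le_prod (fun _ _ => mgf_nonneg) fun i _ => hmgf i
    _ = Real.exp (-(n * a * (1 - Real.exp (-5)))) := by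
        rw [Finset.prod_const, Finset.card_range, ← Real.exp_nat_mul]
        congr 1
        ring

/-- Density counts distinct points while the Chernoff bound counts indices. The diagonal is null for
the product law, since its fibres are single points. -/
theorem ae_injective {X : ℕ → Ω → Plane} (hm : ∀ i, Measurable (X i))
    (hu : ∀ i, pdf.IsUniform (X i) unitSquare μ volume) (hi : iIndepFun X μ) :
    ∀ᵐ ω ∂μ, Function.Injective fun i => X i ω := by
  have key : ∀ i j, i ≠ j → ∀ᵐ ω ∂μ, X i ω ≠ X j ω := by
    intro i j hij
    have hind := (indepFun_iff_map_prod_eq_prod_map_map (hm i).aemeasurable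
      (hm j).aemeasurable).1 (hi.indepFun hij)
    have hdiag : MeasurableSet {z : Plane × Plane | z.1 = z.2} :=
      measurableSet_eq_fun measurable_fst measurable_snd
    have h0 : (Measure.map (fun ω => (X i ω, X j ω)) μ) {z | z.1 = z.2} = 0 := by
      rw [hind]
      have : IsProbabilityMeasure (Measure.map (X j) μ) :=
        Measure.isProbabilityMeasure_map (hm j).aemeasurable
      rw [Measure.measure_prod_null hdiag]
      refine Eventually.of_forall fun x => ?_
      refine (hu j).absolutelyContinuous ?_
      have : Prod.mk x ⁻¹' {z : Plane × Plane | z.1 = z.2} = {x} := by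
        ext y
        simp [eq_comm]
      rw [this]
      simp
    rw [Measure.map_apply ((hm i).prodMk (hm j)) hdiag] at h0
    rw [ae_iff]
    simpa using h0
  have hall : ∀ᵐ ω ∂μ, ∀ i j, i ≠ j → X i ω ≠ X j ω := by
    rw [ae_all_iff]
    intro i
    rw [ae_all_iff]
    intro j
    by_cases hij : i = j
    · simp [hij]
    · simpa [hij] using key i j hij
  filter_upwards [hall] with ω hω i j hij
  by_contra hne
  exact hω i j hne hij

end

/-- If no cell of `S` contains 100 points, then few indices belong to the union of the cells. -/
theorem card_filter_cellUnion_le {Ω : Type*} {X : ℕ → Ω → Plane} {ω : Ω}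
    (hinj : Function.Injective fun i => X i ω) {η r : ℝ} {n : ℕ} {S : Finset (ℤ × ℤ)}
    [DecidablePred (· ∈ cellUnion η r S)]
    (hS : ∀ s ∈ S, ¬100 ≤ (pointSet X n ω ∩ cell η r (latticePoint (η * r) s)).encard) :
    ((Finset.range n).filter fun i => X i ω ∈ cellUnion η r S).card ≤ S.card * 99 := by
  classical
  have hsub : ((Finset.range n).filter fun i => X i ω ∈ cellUnion η r S) ⊆
      S.biUnion fun s => (Finset.range n).filter fun i =>
        X i ω ∈ cell η r (latticePoint (η * r) s) := by
    intro i hi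
    rw [Finset.mem_filter] at hi
    obtain ⟨s, hs, hz⟩ := Set.mem_iUnion₂.1 hi.2
    exact Finset.mem_biUnion.2 ⟨s, hs, Finset.mem_filter.2 ⟨hi.1, hz⟩⟩
  refine (Finset.card_le_card hsub).trans (Finset.card_biUnion_le_card_mul _ _ _ fun s hs => ?_)
  have h1 := hS s hs
  by_contra! hcon
  apply h1
  set F := (Finset.range n).filter fun i => X i ω ∈ cell η r (latticePoint (η * r) s) with hF
  have h2 : ((fun i => X i ω) '' (F : Set ℕ)) ⊆
      pointSet X n ω ∩ cell η r (latticePoint (η * r) s) := by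
    rintro _ ⟨i, hi, rfl⟩
    have hi' := Finset.mem_filter.1 (Finset.mem_coe.1 hi)
    exact ⟨⟨i, Finset.mem_range.1 hi'.1, rfl⟩, hi'.2⟩
  refine le_trans ?_ (Set.encard_le_encard h2)
  rw [hinj.encard_image, Set.encard_coe_eq_coe_finsetCard]
  exact_mod_cast hcon

/-! ### The union bound over windows and the limit. -/

theorem exp_neg_five_le : Real.exp (-5) ≤ 1 / 32 := by
  have h1 : (2 : ℝ) ≤ Real.exp 1 := by linarith [Real.exp_one_gt_d9]
  have h2 : (32 : ℝ) ≤ Real.exp 5 := by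
    have : Real.exp 5 = Real.exp 1 ^ 5 := by rw [← Real.exp_nat_mul]; norm_num
    rw [this]
    calc (32 : ℝ) = 2 ^ 5 := by norm_num
      _ ≤ _ := by gcongr
  rw [Real.exp_neg, ← one_div]
  gcongr

theorem mul_radius_sq {n : ℕ} (hn : 3 ≤ n) : (n : ℝ) * radius n ^ 2 = Real.log n / Real.pi := by
  have hn0 : (0 : ℝ) < n := by exact_mod_cast (by omega : 0 < n)
  have hlog : 0 ≤ Real.log n := Real.log_natCast_nonneg n
  have hpi := Real.pi_pos
  unfold radius
  rw [Real.sq_sqrt (by positivity)]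
  field_simp

theorem one_le_log {n : ℕ} (hn : 3 ≤ n) : 1 ≤ Real.log n := by
  rw [Real.le_log_iff_exp_le (by exact_mod_cast (by omega : 0 < n))]
  have : (3 : ℝ) ≤ n := by exact_mod_cast hn
  linarith [Real.exp_one_lt_d9]

theorem radius_pos {n : ℕ} (hn : 3 ≤ n) : 0 < radius n := by
  have := one_le_log hn
  have hn0 : (0 : ℝ) < n := by exact_mod_cast (by omega : 0 < n)
  have hpi := Real.pi_pos
  unfold radius
  positivity

/-- The weight `n ^ (-(k - 1) / 2)` of a coordinate with `k` far sides. -/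
def sideWeight (n : ℕ) (M L x : ℤ) : ℝ :=
  Real.exp (-(Real.log n * (((farSides M L x).card - 1) / 2)))

theorem card_farSides_eq {M L x : ℤ} (hL : 1 ≤ L) (hM : 2 * L + 2 ≤ M) (h0 : 0 ≤ x) (h1 : x ≤ M) :
    ((farSides M L x).card : ℝ) = 1 ∨ ((farSides M L x).card : ℝ) = 2 := by
  have h2 := card_farSides_le M L x
  have h3 := (farSides_nonempty hL hM h0 h1).card_pos
  have h4 : (farSides M L x).card = 1 ∨ (farSides M L x).card = 2 := by omega
  rcases h4 with h4 | h4
  · left; rw [h4]; norm_num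
  · right; rw [h4]; norm_num

theorem card_farSides_eq_two {M L x : ℤ} (hL : 1 ≤ L) (h0 : L + 1 ≤ x) (h1 : x ≤ M - 1 - L) :
    (farSides M L x).card = 2 := by
  have : farSides M L x = {1, -1} := by
    ext σ
    rw [mem_farSides]
    simp only [Finset.mem_insert, Finset.mem_singleton]
    constructor
    · exact fun h => h.1
    · rintro (rfl | rfl) <;> omega
  rw [this]
  rfl

theorem windowRadius_pos {η : ℝ} (h0 : 0 < η) : 1 ≤ windowRadius η :=
  Int.one_le_ceil_iff.2 (by positivity)

/-- The exponents in the union bound. -/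
theorem exp_mul_exp_le {η : ℝ} (h0 : 0 < η) {M : ℤ}
    (hM : 2 * windowRadius η + 2 ≤ M) {n : ℕ} (hn : 3 ≤ n) {c : ℤ × ℤ} (hc1 : 0 ≤ c.1 ∧ c.1 ≤ M)
    (hc2 : 0 ≤ c.2 ∧ c.2 ≤ M) {s K : ℕ} (hs : threshold η M c ≤ s) (hsK : s ≤ K) :
    Real.exp (5 * ((s * 99 : ℕ) : ℝ)) *
        Real.exp (-(n * (s * (η * radius n) ^ 2) * (1 - Real.exp (-5)))) ≤
      Real.exp (495 * K) * Real.exp (-(0.01 * Real.log n)) *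
        (sideWeight n M (windowRadius η) c.1 * sideWeight n M (windowRadius η) c.2) := by
  have hL := windowRadius_pos h0
  unfold sideWeight
  simp only [← Real.exp_add]
  rw [Real.exp_le_exp]
  have hlog := one_le_log hn
  have hpi := Real.pi_pos
  have hpi2 := Real.pi_lt_d2
  have e5 := exp_neg_five_le
  have hsK' : (s : ℝ) ≤ K := by exact_mod_cast hsK
  have hnr : (n : ℝ) * (s * (η * radius n) ^ 2) = s * η ^ 2 / Real.pi * Real.log n := by
    have := mul_radius_sq hn
    calc (n : ℝ) * (s * (η * radius n) ^ 2) = s * η ^ 2 * (n * radius n ^ 2) := by ring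
      _ = _ := by rw [this]; ring
  rw [hnr]
  unfold threshold at hs
  rw [div_le_iff₀ (by positivity)] at hs
  have hk1 := card_farSides_eq hL hM hc1.1 hc1.2
  have hk2 := card_farSides_eq hL hM hc2.1 hc2.2
  set k₁ : ℝ := ((farSides M (windowRadius η) c.1).card : ℝ)
  set k₂ : ℝ := ((farSides M (windowRadius η) c.2).card : ℝ)
  -- The reserve 0.2 in the threshold becomes 0.2/π > 0.06.
  have hq : k₁ * k₂ / 4 + 0.06 ≤ s * η ^ 2 / Real.pi := by
    rw [le_div_iff₀ hpi]
    nlinarith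
  have hkey : 0.01 + (k₁ - 1) / 2 + (k₂ - 1) / 2 ≤
      s * η ^ 2 / Real.pi * (1 - Real.exp (-5)) := by
    have h31 : 31 / 32 ≤ 1 - Real.exp (-5) := by linarith
    have : (k₁ * k₂ / 4 + 0.06) * (31 / 32) ≤ s * η ^ 2 / Real.pi * (1 - Real.exp (-5)) := by
      refine mul_le_mul hq h31 (by norm_num) (by positivity)
    -- Corner, side and interior windows need 0.01, 0.51 and 1.01. The interior is tightest: 1.06 ·
    -- 31/32 > 1.02.
    rcases hk1 with hk1 | hk1 <;> rcases hk2 with hk2 | hk2 <;> rw [hk1, hk2] at this ⊢ <;> linarith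
  have := mul_le_mul_of_nonneg_left hkey (by linarith : 0 ≤ Real.log n)
  push_cast
  nlinarith

/-- The O(√n) coordinates far from both ends weigh n^(−1/2) each, and the at most `2 * L + 2` others
weigh at most 1, so the sum is bounded uniformly in n. -/
theorem sum_sideWeight_le {η : ℝ} (h0 : 0 < η) {M : ℤ}
    (hM : 2 * windowRadius η + 2 ≤ M) {n : ℕ} (hn : 3 ≤ n) (hMn : (M : ℝ) ≤ 2 / η * √n) :
    ∑ x ∈ Finset.Icc 0 M, sideWeight n M (windowRadius η) x ≤
      2 / η + 1 + (2 * windowRadius η + 2) := by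
  classical
  have hL := windowRadius_pos h0
  have hn0 : (0 : ℝ) < n := by exact_mod_cast (by omega : 0 < n)
  have hlog := one_le_log hn
  set L := windowRadius η with hLdef
  have hsq : Real.exp (-(Real.log n * (1 / 2))) = 1 / √n := by
    rw [Real.exp_neg, ← Real.rpow_def_of_pos hn0, ← Real.sqrt_eq_rpow, one_div]
  have hsn : 1 ≤ √n := by
    rw [Real.one_le_sqrt]
    exact_mod_cast (by omega : 1 ≤ n)
  let N := Finset.Icc 0 L ∪ Finset.Icc (M - L) M
  have hw : ∀ x ∈ Finset.Icc 0 M, sideWeight n M L x ≤ 1 / √n + if x ∈ N then 1 else 0 := by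
    intro x hx
    rw [Finset.mem_Icc] at hx
    by_cases hxN : x ∈ N
    · rw [if_pos hxN]
      have h1 : sideWeight n M L x ≤ 1 := by
        unfold sideWeight
        rw [Real.exp_le_one_iff, neg_nonpos]
        refine mul_nonneg (by linarith) ?_
        rcases card_farSides_eq hL hM hx.1 hx.2 with h | h <;> rw [h] <;> norm_num
      have h2 : 0 ≤ 1 / √(n : ℝ) := by positivity
      linarith
    · rw [if_neg hxN, add_zero]
      simp only [N, Finset.mem_union, Finset.mem_Icc] at hxN
      unfold sideWeight
      rw [card_farSides_eq_two hL (by omega) (by omega), ← hsq]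
      norm_num
  refine (Finset.sum_le_sum hw).trans ?_
  rw [Finset.sum_add_distrib]
  refine add_le_add ?_ ?_
  · rw [Finset.sum_const, nsmul_eq_mul, Int.card_Icc]
    have : (((M + 1 - 0).toNat : ℕ) : ℝ) = M + 1 := by
      have h : (((M + 1 - 0).toNat : ℕ) : ℤ) = M + 1 := by omega
      exact_mod_cast h
    rw [this, mul_one_div, div_le_iff₀ (by linarith)]
    nlinarith
  · rw [Finset.sum_boole]
    have h1 : ((Finset.Icc 0 M).filter (· ∈ N)).card ≤ N.card :=
      Finset.card_le_card fun x hx => (Finset.mem_filter.1 hx).2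
    have h2 : N.card ≤ (Finset.Icc 0 L).card + (Finset.Icc (M - L) M).card :=
      Finset.card_union_le _ _
    rw [Int.card_Icc, Int.card_Icc] at h2
    have h3 : ((((Finset.Icc 0 M).filter (· ∈ N)).card : ℤ)) ≤ 2 * L + 2 := by omega
    exact_mod_cast h3

theorem card_windowCells_le (M L : ℤ) (c : ℤ × ℤ) :
    (windowCells M L c).card ≤ (2 * L + 1).toNat * (2 * L + 1).toNat := by
  unfold windowCells
  rw [Finset.card_product]
  refine Nat.mul_le_mul ?_ ?_ <;> refine (Finset.card_le_card Finset.inter_subset_left).trans ?_ <;>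
    rw [Int.card_Icc] <;> omega

theorem meshCount_le {η : ℝ} (h0 : 0 < η) {n : ℕ} (hn : 3 ≤ n) :
    (meshCount η (radius n) : ℝ) ≤ 2 / η * √n := by
  have hr := radius_pos hn
  have hlog := one_le_log hn
  have hpi := Real.pi_pos
  have hpi4 := Real.pi_lt_four
  have hn0 : (0 : ℝ) < n := by exact_mod_cast (by omega : 0 < n)
  refine (Int.floor_le _).trans ?_
  have h1 : 1 ≤ radius n * (2 * √n) := by
    have h2 : (radius n * (2 * √n)) ^ 2 = 4 * (n * radius n ^ 2) := by
      rw [mul_pow, mul_pow, Real.sq_sqrt hn0.le]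
      ring
    have h3 : 1 ≤ (radius n * (2 * √n)) ^ 2 := by
      rw [h2, mul_radius_sq hn, ← mul_div_assoc, le_div_iff₀ hpi]
      linarith
    have h4 : 0 ≤ radius n * (2 * √n) := by positivity
    nlinarith
  rw [div_le_iff₀ (by positivity)]
  calc 1 ≤ radius n * (2 * √n) := h1
    _ = 2 / η * √n * (η * radius n) := by field_simp

theorem tendsto_radius : Tendsto radius atTop (𝓝 0) := by
  have h1 : Tendsto (fun x : ℝ => Real.log x ^ 1 / (Real.pi * x + 0)) atTop (𝓝 0) :=
    Real.tendsto_pow_log_div_mul_add_atTop _ _ _ Real.pi_ne_zero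
  have h2 := (h1.comp tendsto_natCast_atTop_atTop).sqrt
  rw [Real.sqrt_zero] at h2
  refine h2.congr fun n => ?_
  simp [radius]

theorem eventually_le_meshCount {η : ℝ} (h0 : 0 < η) (B : ℤ) :
    ∀ᶠ n in atTop, B ≤ meshCount η (radius n) := by
  have hB : 0 < 1 / (η * (|(B : ℝ)| + 1)) := by positivity
  filter_upwards [tendsto_radius.eventually_lt_const hB, eventually_ge_atTop 3] with n hn hn3
  have hr := radius_pos hn3
  refine Int.le_floor.2 ?_
  rw [le_div_iff₀ (by positivity)]
  rw [lt_div_iff₀ (by positivity)] at hn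
  nlinarith [le_abs_self (B : ℝ), mul_pos h0 hr]

open Classical in
/-- The event that some window contains many sparse cells, up to coincidences of points. -/
def sparseEvent {Ω : Type*} (X : ℕ → Ω → Plane) (η : ℝ) (n : ℕ) : Set Ω :=
  ⋃ c ∈ Finset.Icc 0 (meshCount η (radius n)) ×ˢ Finset.Icc 0 (meshCount η (radius n)),
    ⋃ S ∈ (windowCells (meshCount η (radius n)) (windowRadius η) c).powerset.filter
      fun S => threshold η (meshCount η (radius n)) c ≤ S.card,
      {ω | ((Finset.range n).filter fun i => X i ω ∈ cellUnion η (radius n) S).card ≤ S.card * 99}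

theorem goodStructure_of_notMem_sparseEvent {Ω : Type*} {X : ℕ → Ω → Plane} {η : ℝ} (h0 : 0 < η)
    (h1 : η < 1 / 1000) {n : ℕ} (hn : 3 ≤ n)
    (hM : 2 * windowRadius η + 2 ≤ meshCount η (radius n)) {ω : Ω}
    (hinj : Function.Injective fun i => X i ω) (hω : ω ∉ sparseEvent X η n) :
    GoodStructure η (pointSet X n ω) (radius n) := by
  classical
  refine SparseBound.goodStructure ⟨fun q hq => hq.1, fun c hc1 hc2 S hS hSD => ?_⟩ h0 h1
    (radius_pos hn) hM
  by_contra! hcon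
  apply hω
  unfold sparseEvent
  simp only [Set.mem_iUnion]
  refine ⟨c, ?_, S, ?_, ?_⟩
  · rw [Finset.mem_product, Finset.mem_Icc, Finset.mem_Icc]
    exact ⟨hc1, hc2⟩
  · rw [Finset.mem_filter, Finset.mem_powerset]
    exact ⟨hS, hcon⟩
  · refine card_filter_cellUnion_le hinj fun s hs h100 => hSD s hs ⟨?_, h100⟩
    have := mem_windowCells.1 (hS hs)
    omega

/-- A bound for the constant in the probability of `sparseEvent`. -/
def eventConstant (η : ℝ) : ℝ :=
  2 ^ ((2 * windowRadius η + 1).toNat * (2 * windowRadius η + 1).toNat) *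
    Real.exp (495 * (((2 * windowRadius η + 1).toNat * (2 * windowRadius η + 1).toNat : ℕ) : ℝ)) *
      (2 / η + 1 + (2 * windowRadius η + 2)) ^ 2

section
variable {Ω : Type*} [MeasurableSpace Ω] {μ : Measure Ω} [IsProbabilityMeasure μ]

/-- A window has at most `2 ^ K` sets of cells with `K` independent of n, and the sum over centres
factors into the square of a one-dimensional sum of weights. -/
theorem measureReal_sparseEvent_le {X : ℕ → Ω → Plane} (hm : ∀ i, Measurable (X i))
    (hu : ∀ i, pdf.IsUniform (X i) unitSquare μ volume) (hi : iIndepFun X μ)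
    {η : ℝ} (h0 : 0 < η) {n : ℕ} (hn : 3 ≤ n)
    (hM : 2 * windowRadius η + 2 ≤ meshCount η (radius n)) :
    μ.real (sparseEvent X η n) ≤ eventConstant η * Real.exp (-(0.01 * Real.log n)) := by
  classical
  have hr := radius_pos hn
  have hh := mul_pos h0 hr
  set M := meshCount η (radius n) with hMdef
  set L := windowRadius η with hLdef
  set K := (2 * L + 1).toNat * (2 * L + 1).toNat with hK
  set ε := Real.exp (-(0.01 * Real.log n)) with hε
  have hone : ∀ c ∈ Finset.Icc 0 M ×ˢ Finset.Icc 0 M, ∀ S ∈ (windowCells M L c).powerset.filter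
      fun S => threshold η M c ≤ S.card,
      μ.real {ω | ((Finset.range n).filter fun i =>
        X i ω ∈ cellUnion η (radius n) S).card ≤ S.card * 99} ≤
      Real.exp (495 * (K : ℝ)) * ε * (sideWeight n M L c.1 * sideWeight n M L c.2) := by
    intro c hc S hS
    rw [Finset.mem_product, Finset.mem_Icc, Finset.mem_Icc] at hc
    rw [Finset.mem_filter, Finset.mem_powerset] at hS
    refine (measureReal_card_le_le hm hi (measurableSet_cellUnion _ _ _)
      (fun i => measureReal_preimage_cellUnion (hu i) hh fun s hs => ?_) n _).trans ?_
    · have := mem_windowCells.1 (hS.1 hs)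
      exact ⟨this.1.2, this.2.2⟩
    · exact exp_mul_exp_le h0 hM hn hc.1 hc.2 hS.2
        ((Finset.card_le_card hS.1).trans (card_windowCells_le _ _ _))
  have hwin : ∀ c ∈ Finset.Icc 0 M ×ˢ Finset.Icc 0 M,
      μ.real (⋃ S ∈ (windowCells M L c).powerset.filter fun S => threshold η M c ≤ S.card,
        {ω | ((Finset.range n).filter fun i =>
          X i ω ∈ cellUnion η (radius n) S).card ≤ S.card * 99}) ≤
      2 ^ K * Real.exp (495 * (K : ℝ)) * ε * (sideWeight n M L c.1 * sideWeight n M L c.2) := by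
    intro c hc
    refine (measureReal_biUnion_finset_le _ _).trans ((Finset.sum_le_sum (hone c hc)).trans ?_)
    rw [Finset.sum_const, nsmul_eq_mul]
    have hcard : (((windowCells M L c).powerset.filter fun S =>
        threshold η M c ≤ S.card).card : ℝ) ≤ 2 ^ K := by
      have h1 : ((windowCells M L c).powerset.filter fun S =>
          threshold η M c ≤ S.card).card ≤ 2 ^ K := by
        refine (Finset.card_filter_le _ _).trans ?_
        rw [Finset.card_powerset]
        exact Nat.pow_le_pow_right (by norm_num) (card_windowCells_le _ _ _)
      exact_mod_cast h1
    have hpos : 0 ≤ Real.exp (495 * (K : ℝ)) * ε * (sideWeight n M L c.1 * sideWeight n M L c.2) := by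
      unfold sideWeight
      positivity
    refine (mul_le_mul_of_nonneg_right hcard hpos).trans (le_of_eq (by ring))
  have hsum := sum_sideWeight_le h0 hM hn (meshCount_le h0 hn)
  rw [← hLdef] at hsum
  have hsum0 : 0 ≤ ∑ x ∈ Finset.Icc 0 M, sideWeight n M L x :=
    Finset.sum_nonneg fun x _ => (Real.exp_pos _).le
  calc μ.real (sparseEvent X η n)
      ≤ ∑ c ∈ Finset.Icc 0 M ×ˢ Finset.Icc 0 M,
          2 ^ K * Real.exp (495 * (K : ℝ)) * ε * (sideWeight n M L c.1 * sideWeight n M L c.2) :=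
        (measureReal_biUnion_finset_le _ _).trans (Finset.sum_le_sum hwin)
    _ = 2 ^ K * Real.exp (495 * (K : ℝ)) * ε * (∑ x ∈ Finset.Icc 0 M, sideWeight n M L x) ^ 2 := by
        rw [← Finset.mul_sum, Finset.sum_product, sq, Finset.sum_mul_sum]
    _ ≤ 2 ^ K * Real.exp (495 * (K : ℝ)) * ε * (2 / η + 1 + (2 * L + 2)) ^ 2 := by
        gcongr
    _ = eventConstant η * ε := by
        unfold eventConstant
        rw [← hLdef, ← hK]
        ring

theorem tendsto_eventBound (C : ℝ) :
    Tendsto (fun n : ℕ => C * Real.exp (-(0.01 * Real.log n))) atTop (𝓝 0) := by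
  have h1 : Tendsto (fun n : ℕ => 0.01 * Real.log n) atTop atTop :=
    (Real.tendsto_log_atTop.comp tendsto_natCast_atTop_atTop).const_mul_atTop (by norm_num)
  have h2 := (Real.tendsto_exp_neg_atTop_nhds_zero.comp h1).const_mul C
  rwa [mul_zero] at h2

theorem tendsto_measure_goodStructure {X : ℕ → Ω → Plane} (hm : ∀ i, Measurable (X i))
    (hu : ∀ i, pdf.IsUniform (X i) unitSquare μ volume) (hi : iIndepFun X μ)
    {η : ℝ} (h0 : 0 < η) (h1 : η < 1 / 1000) :
    Tendsto (fun n : ℕ => μ {ω | GoodStructure η (pointSet X n ω) (radius n)}) atTop (𝓝 1) := by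
  have hlow : Tendsto (fun n : ℕ => 1 - ENNReal.ofReal
      (eventConstant η * Real.exp (-(0.01 * Real.log n)))) atTop (𝓝 1) := by
    have := ENNReal.tendsto_ofReal (tendsto_eventBound (eventConstant η))
    rw [ENNReal.ofReal_zero] at this
    have h2 := ENNReal.Tendsto.sub (tendsto_const_nhds (x := (1 : ENNReal))) this
      (Or.inl ENNReal.one_ne_top)
    rwa [tsub_zero] at h2
  refine tendsto_of_tendsto_of_tendsto_of_le_of_le' hlow tendsto_const_nhds ?_
    (Eventually.of_forall fun n => prob_le_one)
  filter_upwards [eventually_ge_atTop 3, eventually_le_meshCount h0 (2 * windowRadius η + 2)]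
    with n hn hM
  -- Subadditivity holds for arbitrary sets, so measurability of the two events is not needed.
  have hcover : (1 : ENNReal) ≤ μ {ω | GoodStructure η (pointSet X n ω) (radius n)} +
      μ (sparseEvent X η n) := by
    rw [← measure_univ (μ := μ)]
    refine le_trans (measure_mono_ae ?_) (measure_union_le _ _)
    filter_upwards [ae_injective hm hu hi] with ω hinj _
    by_cases hω : ω ∈ sparseEvent X η n
    · exact Or.inr hω
    · exact Or.inl (goodStructure_of_notMem_sparseEvent h0 h1 hn hM hinj hω)
  have hle : μ (sparseEvent X η n) ≤
      ENNReal.ofReal (eventConstant η * Real.exp (-(0.01 * Real.log n))) := by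
    rw [← ofReal_measureReal]
    exact ENNReal.ofReal_le_ofReal (measureReal_sparseEvent_le hm hu hi h0 hn hM)
  rw [tsub_le_iff_right]
  exact hcover.trans (by gcongr)

end

end HamRGG
end

theorem proposition5 :
    ∃ η₀ : ℝ, 0 < η₀ ∧ η₀ ≤ 1 / √2 ∧
      ∀ η : ℝ, 0 < η → η < η₀ →
        ∀ (Ω : Type*) [MeasurableSpace Ω] (μ : Measure Ω) [IsProbabilityMeasure μ]
          (X : ℕ → Ω → HamRGG.Plane),
          (∀ i, Measurable (X i)) →
          (∀ i, pdf.IsUniform (X i) HamRGG.unitSquare μ volume) →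
          iIndepFun X μ →
          Tendsto
            (fun n : ℕ =>
              μ {ω | HamRGG.GoodStructure η (HamRGG.pointSet X n ω) (HamRGG.radius n)})
            atTop (𝓝 1) := by
  refine ⟨1 / 1000, by norm_num, ?_, ?_⟩
  · have h : √2 ≤ 1000 := Real.sqrt_le_iff.2 ⟨by norm_num, by norm_num⟩
    exact one_div_le_one_div_of_le (by positivity) h
  · intro η h0 h1 Ω _ μ _ X hm hu hi
    exact HamRGG.tendsto_measure_goodStructure hm hu hi h0 h1
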